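/- Let $n\ge 1$, $R=\lfloor n/2\rfloor$, and let $B$ be the group of real upper triangular $n\times n$ matrices with positive diagonal entries, $N\subset B$ its unipotent subgroup, $\mathfrak n$ the Lie algebra of strictly upper triangular matrices, and $\mathfrak n_-\cong\mathfrak n^*$ (by the trace form) the strictly lower triangular matrices. For $1\le r\le R$ put $d_r=n-2r$; let $\mathfrak s=\bigoplus_{r}\mathbb R\,e_{r,n-r+1}$, and write $\lambda\in\mathfrak s^*$ as $(\lambda_1,\dots,\lambda_R)$. Put $\rho(\lambda)=\prod_r\lambda_r^{d_r}$, $\mathrm{Det}_{\mathfrak s^*}(\lambda)=\prod_r\lambda_r$ and $\delta_B(b)=\prod_r (b_{rr}/b_{n-r+1,n-r+1})^{d_r+1}$. For $X\in\mathfrak n_-$ let $E_{0,r}(X)$ be the coefficient of $\eta^{n-2r}$ in the determinant of the matrix obtained from $X-\eta\mathbb I$ by deleting the first $r$ rows and the last $r$ columns ($E_{0,r}$ for $0\le r\le R$). For $X\in\mathfrak n$ let $\tilde X f(b)=\frac{d}{dt}f(b\exp tX)|_{t=0}$ on $C^\infty(B)$. Let $K\subset N$ be the connected subgroup with Lie algebra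 $\mathrm{span}\{e_{i,j}: i<j\le n-i+1\}$, which polarizes every $\lambda\in\mathfrak s^*$ with all $\lambda_r\neq0$. There is exactly one operator $D$ on $C^\infty(B)$ (Wolf's Dixmier–Pukanszky operator) such that: (a) $D$ lies in the complex algebra generated by the fields $\tilde X$, $X\in\mathfrak n$; (b) $D$ is $\mathrm{Ad}(B)$-semi-invariant of weight $\delta_B$, i.e. $R_cDR_c^{-1}=\delta_B(c)D$ for $c\in B$, where $(R_cf)(b)=f(bc)$ (so $D$ is bi-invariant along $N$); (c) $D$ has Fourier multiplier $\rho\cdot\mathrm{Det}_{\mathfrak s^*}$: for every $\lambda$ with all $\lambda_r\ne0$ and every $f\in C^\infty(B)$ with $f(bk)=e^{i\sum_r\lambda_r k_{r,n-r+1}}f(b)$ for all $b\in B$, $k\in K$, one has $Df=\rho(\lambda)\,\mathrm{Det}_{\mathfrak s^*}(\lambda)\,f$. Let $\sigma_c$, for $c\in\mathbb C$, be the real-linear map from real polynomials on $\mathfrak n_-$ (that is, $\mathbb S(\mathfrak n)$) to operators on $C^\infty(B)$ with $\sigma_c(X^m)=(c\tilde X)^m$ for $X\in\mathfrak n$. There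 is exactly one real polynomial $P$ with $\sigma_{-i}(P)=D$, called the symbol $\sigma(D)$ of $D$. It is invariant under the coadjoint action of $N$ on $\mathfrak n_-$, it can be written in exactly one way as a polynomial in $E_{0,1},\dots,E_{0,R}$, and $$\sigma(D)=\prod_{r=1}^{R}E_{0,r}^2\quad(n\text{ odd}),\qquad \sigma(D)=(-1)^{R(R-1)/2}\,E_{0,R}\prod_{r=1}^{R-1}E_{0,r}^2\quad(n\text{ even}).$$ It is homogeneous of degree $d=R(R+1)$ for $n$ odd and $d=R^2$ for $n$ even, and $D=(-i)^{d}\,\sigma_1(P)$. In both cases $d=\tfrac12(\dim\mathfrak n+\dim\mathfrak s)$, and $d$ is the order of the differential operator $D$. -/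

import Mathlib

open scoped ContDiff

noncomputable section

namespace DixmierPukanszky

/-! ### The group `B`, its smooth functions, and left-invariant differential operators -/

/-- The group `B` of real upper triangular `n × n` matrices with positive diagonal entries. -/
def borel (n : ℕ) : Subgroup (GL (Fin n) ℝ) where
  carrier := {g | (∀ i j, j < i → g.1 i j = 0) ∧ ∀ i, 0 < g.1 i i}
  one_mem' := by
    refine ⟨fun i j h => ?_, fun i => ?_⟩
    · simp [h.ne']
    · simp
  mul_mem' := by
    rintro a b ⟨ha, ha'⟩ ⟨hb, hb'⟩
    refine ⟨fun i j h => ?_, fun i => ?_⟩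
    · rw [Units.val_mul, Matrix.mul_apply]
      refine Finset.sum_eq_zero fun k _ => ?_
      rcases lt_or_ge k i with hk | hk
      · rw [ha i k hk, zero_mul]
      · rw [hb k j (h.trans_le hk), mul_zero]
    · rw [Units.val_mul, Matrix.mul_apply, Finset.sum_eq_single i]
      · exact mul_pos (ha' i) (hb' i)
      · intro k _ hk
        rcases lt_or_gt_of_ne hk with hk | hk
        · rw [ha i k hk, zero_mul]
        · rw [hb k i hk, mul_zero]
      · simp
  inv_mem' := by
    rintro a ⟨ha, ha'⟩
    have hbt : Matrix.BlockTriangular a.1 id := fun i j h => ha i j h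
    have hinv : Matrix.BlockTriangular (a⁻¹).1 id := by
      have : Invertible a.1 := a.invertible
      have := Matrix.blockTriangular_inv_of_blockTriangular hbt
      rwa [← Matrix.coe_units_inv] at this
    refine ⟨fun i j h => hinv h, fun i => ?_⟩
    have h1 : (a.1 * (a⁻¹).1) i i = 1 := by
      rw [← Units.val_mul, mul_inv_cancel]; simp
    rw [Matrix.mul_apply, Finset.sum_eq_single i] at h1
    · exact (mul_pos_iff_of_pos_left (ha' i)).1 (h1 ▸ one_pos)
    · intro k _ hk
      rcases lt_or_gt_of_ne hk with hk | hk
      · rw [ha i k hk, zero_mul]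
      · rw [hinv hk, mul_zero]
    · simp

variable {n : ℕ}

/-- The matrix entries of an element of `B`. -/
def entry (b : borel n) (i j : Fin n) : ℝ := b.1.1 i j

/-- The open set of arrays with positive diagonal; `B` is the intersection of this set with the
linear subspace of upper triangular arrays. -/
def posDiag (n : ℕ) : Set (Fin n → Fin n → ℝ) := {x | ∀ i, 0 < x i i}

/-- A function on `B` is smooth if it is the restriction of a smooth function of the matrix
entries (`B` is a closed submanifold, and a smooth retract, of `posDiag n`). -/
def IsSmooth (f : borel n → ℂ) : Prop :=
  ∃ F : (Fin n → Fin n → ℝ) → ℂ, ContDiffOn ℝ ∞ F (posDiag n) ∧ ∀ b, f b = F (entry b)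

/-- The algebra `C^∞(B)` of smooth complex-valued functions on `B`. -/
def smoothFn (n : ℕ) : Subalgebra ℂ (borel n → ℂ) where
  carrier := {f | IsSmooth f}
  mul_mem' := by
    rintro f g ⟨F, hF, hf⟩ ⟨G, hG, hg⟩
    exact ⟨fun x => F x * G x, hF.mul hG, fun b => by simp [hf, hg]⟩
  add_mem' := by
    rintro f g ⟨F, hF, hf⟩ ⟨G, hG, hg⟩
    exact ⟨fun x => F x + G x, hF.add hG, fun b => by simp [hf, hg]⟩
  algebraMap_mem' c := ⟨fun _ => c, contDiffOn_const, fun _ => rfl⟩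

/-- Index set of the basis `e_{i,j}`, `i < j`, of the Lie algebra `𝔫` of strictly upper
triangular matrices. -/
abbrev PosRoot (n : ℕ) : Type := {p : Fin n × Fin n // p.1 < p.2}

/-- The one-parameter subgroup `exp (t e_{i,j}) = 1 + t e_{i,j}` of `B`, for `i < j`. -/
def rootExp (p : PosRoot n) (t : ℝ) : borel n :=
  ⟨Matrix.GeneralLinearGroup.mkOfDetNeZero (Matrix.transvection p.1.1 p.1.2 t)
      (by rw [Matrix.det_transvection_of_ne _ _ p.2.ne]; exact one_ne_zero), by
    have hp := p.2
    refine ⟨fun i j h => ?_, fun i => ?_⟩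
    · change (Matrix.transvection p.1.1 p.1.2 t) i j = 0
      have : ¬ (p.1.1 = i ∧ p.1.2 = j) := by
        rintro ⟨h1, h2⟩; rw [h1, h2] at hp; exact absurd hp h.asymm
      simp [Matrix.transvection, h.ne', this]
    · change 0 < (Matrix.transvection p.1.1 p.1.2 t) i i
      have : ¬ (p.1.1 = i ∧ p.1.2 = i) := by
        rintro ⟨h1, h2⟩; rw [h1, h2] at hp; exact lt_irrefl _ hp
      simp [Matrix.transvection, this]⟩

theorem entry_mul_rootExp (b : borel n) (p : PosRoot n) (t : ℝ) :
    entry (b * rootExp p t) =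
      entry b + t • fun i j => if p.1.2 = j then entry b i p.1.1 else 0 := by
  funext i j
  change (b.1.1 * Matrix.transvection p.1.1 p.1.2 t) i j = _
  rw [Matrix.transvection, mul_add, mul_one, Matrix.add_apply]
  by_cases h : p.1.2 = j
  · subst h
    simp [entry, mul_comm]
  · simp [entry, h, Matrix.mul_single_apply_of_ne _ _ _ _ _ (Ne.symm h)]

theorem entry_mem_posDiag (b : borel n) : entry b ∈ posDiag n := b.2.2

theorem isOpen_posDiag (n : ℕ) : IsOpen (posDiag n) := by
  have : posDiag n = ⋂ i, {x | 0 < x i i} := by ext; simp [posDiag]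
  rw [this]
  exact isOpen_iInter_of_finite fun i => isOpen_lt continuous_const (by fun_prop)

theorem hasDerivAt_rootExp {f : borel n → ℂ} {F : (Fin n → Fin n → ℝ) → ℂ}
    (hF : ContDiffOn ℝ ∞ F (posDiag n)) (hf : ∀ b, f b = F (entry b))
    (p : PosRoot n) (b : borel n) :
    HasDerivAt (fun t : ℝ => f (b * rootExp p t))
      (fderiv ℝ F (entry b) fun i j => if p.1.2 = j then entry b i p.1.1 else 0) 0 := by
  have hd : DifferentiableAt ℝ F (entry b) :=
    (hF.contDiffAt ((isOpen_posDiag n).mem_nhds (entry_mem_posDiag b))).differentiableAt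
      (by simp)
  have h1 : HasDerivAt (fun t : ℝ => entry b + t • fun i j =>
      if p.1.2 = j then entry b i p.1.1 else (0 : ℝ))
      (fun i j => if p.1.2 = j then entry b i p.1.1 else (0 : ℝ)) 0 := by
    have := ((hasDerivAt_id (0 : ℝ)).smul_const (fun i j : Fin n =>
      if p.1.2 = j then entry b i p.1.1 else (0 : ℝ))).const_add (entry b)
    simpa using this
  have h2 : HasFDerivAt F (fderiv ℝ F (entry b)) (entry b + (0 : ℝ) • fun i j =>
      if p.1.2 = j then entry b i p.1.1 else (0 : ℝ)) := by
    simpa using hd.hasFDerivAt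
  have h3 := h2.comp_hasDerivAt (0 : ℝ) h1
  refine h3.congr_of_eventuallyEq (Filter.Eventually.of_forall fun t => ?_)
  simp only [Function.comp, hf, entry_mul_rootExp]

/-- Linear operators on `C^∞(B)`. -/
abbrev Op (n : ℕ) : Type := Module.End ℂ (smoothFn n)

/-- The left-invariant vector field `X̃` of `X = e_{i,j} ∈ 𝔫` on `B`:
`(X̃ f)(b) = d/dt f(b exp(tX))` at `t = 0`. -/
def vectorField (p : PosRoot n) : Op n where
  toFun f := ⟨fun b => deriv (fun t : ℝ => f.1 (b * rootExp p t)) 0, by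
    obtain ⟨F, hF, hf⟩ := f.2
    refine ⟨fun x => fderiv ℝ F x fun i j => if p.1.2 = j then x i p.1.1 else 0, ?_, fun b =>
      (hasDerivAt_rootExp hF hf p b).deriv⟩
    have h1 : ContDiffOn ℝ ∞ (fderiv ℝ F) (posDiag n) :=
      hF.fderiv_of_isOpen (isOpen_posDiag n) (by simp)
    refine h1.clm_apply (ContDiff.contDiffOn ?_)
    refine contDiff_pi.2 fun i => contDiff_pi.2 fun j => ?_
    split_ifs
    · fun_prop
    · exact contDiff_const⟩
  map_add' f g := by
    obtain ⟨F, hF, hf⟩ := f.2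
    obtain ⟨G, hG, hg⟩ := g.2
    ext b
    exact ((hasDerivAt_rootExp hF hf p b).differentiableAt.hasDerivAt.add
      (hasDerivAt_rootExp hG hg p b).differentiableAt.hasDerivAt).deriv
  map_smul' c f := by
    obtain ⟨F, hF, hf⟩ := f.2
    ext b
    exact ((hasDerivAt_rootExp hF hf p b).differentiableAt.hasDerivAt.const_smul c).deriv

/-- The algebra of left-invariant differential operators (with complex coefficients) on `B` that
differentiate along `N`, i.e. the image of the enveloping algebra of `𝔫`. -/
def leftInvariantOps (n : ℕ) : Subalgebra ℂ (Op n) :=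
  Algebra.adjoin ℂ (Set.range vectorField)

/-- Right translation `(R_c f)(b) = f(bc)` on `C^∞(B)`. -/
def rightTranslation (c : borel n) : Op n where
  toFun f := ⟨fun b => f.1 (b * c), by
    obtain ⟨F, hF, hf⟩ := f.2
    refine ⟨fun x => F fun i j => ∑ k, (if k < i then 0 else x i k) * entry c k j, ?_, fun b => ?_⟩
    · refine hF.comp (ContDiff.contDiffOn ?_) fun x hx i => ?_
      · refine contDiff_pi.2 fun i => contDiff_pi.2 fun j => ContDiff.sum fun k _ => ?_
        split_ifs
        · simpa using contDiff_const
        · fun_prop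
      · rw [Finset.sum_eq_single i]
        · simpa using mul_pos (hx i) (entry_mem_posDiag c i)
        · intro k _ hk
          rcases lt_or_gt_of_ne hk with hk | hk
          · simp [hk]
          · have : entry c k i = 0 := c.2.1 k i hk
            simp [this]
        · simp
    · refine (hf (b * c)).trans (congrArg F ?_)
      funext i j
      change (b.1.1 * c.1.1) i j = _
      rw [Matrix.mul_apply]
      refine Finset.sum_congr rfl fun k _ => ?_
      split_ifs with h
      · rw [b.2.1 i k h]; rfl
      · rfl⟩
  map_add' _ _ := rfl
  map_smul' _ _ := rfl

/-- `D` has order at most `k`: at every point `b`, it kills the `(k+1)`-st power of the ideal of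
smooth functions vanishing at `b`. -/
def OrderLE (D : Op n) (k : ℕ) : Prop :=
  ∀ (b : borel n) (f : Fin (k + 1) → smoothFn n),
    (∀ i, (f i).1 b = 0) → (D (∏ i, f i)).1 b = 0

/-- `D` is a differential operator of order exactly `k`. -/
def HasOrder (D : Op n) (k : ℕ) : Prop :=
  OrderLE D k ∧ ∀ j < k, ¬ OrderLE D j

/-! ### The symmetric algebra of `𝔫` and symbols -/

/-- The symmetric algebra `𝕊(𝔫)`, as polynomials in the basis `e_{i,j}`, `i < j`.  Through the
trace form it is the algebra of polynomial functions on `𝔫₋ = 𝔫^*`, with `e_{i,j}` the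
coordinate `X ↦ tr (e_{i,j} X) = X_{j,i}`. -/
abbrev SymAlg (n : ℕ) : Type := MvPolynomial (PosRoot n) ℝ

/-- The average, over all orderings `X₁, …, X_m` of a finite list of basis elements of `𝔫`, of the
products `(c X̃₁) ⋯ (c X̃_m)`. -/
def averagedProduct (c : ℂ) (l : List (PosRoot n)) : Op n :=
  let V : PosRoot n → Op n := fun p => c • vectorField p
  let total : Op n :=
    ∑ π : Equiv.Perm (Fin l.length), (List.ofFn fun k => V (l.get (π k))).prod
  ((l.length.factorial : ℂ)⁻¹) • total

/-- The symmetrization map `𝕊(𝔫) → 𝔻(N)`, scaled by `c`: it sends a monomial in basis elements to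
the average of the products of the corresponding operators `c X̃` over all orderings.  It is the
linear map with `X^m ↦ (c X̃)^m` for `X ∈ 𝔫`. -/
def symmetrization (n : ℕ) (c : ℂ) : SymAlg n →ₗ[ℝ] Op n :=
  (MvPolynomial.basisMonomials (PosRoot n) ℝ).constr ℝ fun s =>
    averagedProduct c (Finsupp.toMultiset s).toList

/-- `P ∈ 𝕊(𝔫)` is the symbol of `D`, in the normalization fitting the Fourier transform
`∫ f(z) e^{-i(λ,z)} dz`: the symbol of `-i X̃` is `X`, so that real symbols belong to formally
self-adjoint operators. -/
def IsSymbol (P : SymAlg n) (D : Op n) : Prop :=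
  symmetrization n (-Complex.I) P = D

/-- Invariance of a polynomial function on `𝔫₋` under the coadjoint action
`X ↦ π_{𝔫₋}(g⁻¹ X g)` of the group `N` of unipotent elements of `B`. -/
def IsCoadjointInvariant (P : SymAlg n) : Prop :=
  ∀ g : borel n, (∀ i, entry g i i = 1) →
    ∀ X : Matrix (Fin n) (Fin n) ℝ, (∀ i j, i ≤ j → X i j = 0) →
      MvPolynomial.eval (fun p => ((g⁻¹).1.1 * X * g.1.1) p.1.2 p.1.1) P =
        MvPolynomial.eval (fun p => X p.1.2 p.1.1) P

/-- The generic element `X` of `𝔫₋`, whose entries below the diagonal are the coordinates. -/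
def genericLower (n : ℕ) : Matrix (Fin n) (Fin n) (SymAlg n) :=
  Matrix.of fun i j => if h : j < i then MvPolynomial.X ⟨(j, i), h⟩ else 0

/-- The `r`-chop: remove the first `r` rows and the last `r` columns. -/
def chop {A : Type*} (M : Matrix (Fin n) (Fin n) A) (r : ℕ) :
    Matrix (Fin (n - r)) (Fin (n - r)) A :=
  M.submatrix (fun i => ⟨i.1 + r, by omega⟩) (fun j => ⟨j.1, by omega⟩)

/-- `E_{0,r}(X)`, `X ∈ 𝔫₋`: the coefficient of `η^{n-2r}` in `det (X - η 1)_{(r)}`. -/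
def chopInvariant (n r : ℕ) : SymAlg n :=
  (chop ((genericLower n).map Polynomial.C -
    Matrix.scalar (Fin n) (Polynomial.X : Polynomial (SymAlg n))) r).det.coeff (n - 2 * r)

/-! ### The Heisenberg strata and the Dixmier–Pukanszky operator -/

/-- The index `r`, `r = 1, …, R = ⌊n/2⌋` (counted from `0` here), as a row number. -/
def cascadeRow (r : Fin (n / 2)) : Fin n := ⟨r.1, by omega⟩

/-- The column `n - r + 1` of the central element `e_{r,n-r+1}` of the `r`-th stratum. -/
def cascadeCol (r : Fin (n / 2)) : Fin n := (cascadeRow r).rev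

/-- `d_r = ½ dim (𝔪_r / 𝔷_r) = n - 2r`. -/
def stratumDim (r : Fin (n / 2)) : ℕ := n - 2 * (r.1 + 1)

/-- The Lie algebra `𝔫` of strictly upper triangular matrices, as a vector space. -/
def nilradical (n : ℕ) : Submodule ℝ (Matrix (Fin n) (Fin n) ℝ) where
  carrier := {X | ∀ i j, j ≤ i → X i j = 0}
  add_mem' hX hY i j h := by simp [hX i j h, hY i j h]
  zero_mem' := by simp
  smul_mem' c X hX i j h := by simp [hX i j h]

/-- `𝔰 = ⨁ 𝔷_r`, spanned by the elements `e_{r,n-r+1}`. -/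
def centers (n : ℕ) : Submodule ℝ (Matrix (Fin n) (Fin n) ℝ) :=
  Submodule.span ℝ (Set.range fun r : Fin (n / 2) =>
    Matrix.single (cascadeRow r) (cascadeCol r) (1 : ℝ))

/-- The Pfaffian `ρ(λ) = ∏ λ_r^{d_r}` on `𝔰^*`. -/
def pfaffian (lam : Fin (n / 2) → ℝ) : ℝ := ∏ r, lam r ^ stratumDim r

/-- `Det_{𝔰^*}(λ) = ∏ β_r(λ) = ∏ λ_r`. -/
def detCenters (lam : Fin (n / 2) → ℝ) : ℝ := ∏ r, lam r

/-- The modular function `δ_B(an) = ∏ (a_r / a_{n-r+1})^{d_r + 1}`. -/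
def modularWeight (b : borel n) : ℝ :=
  ∏ r : Fin (n / 2), (entry b (cascadeRow r) (cascadeRow r) /
    entry b (cascadeCol r) (cascadeCol r)) ^ (stratumDim r + 1)

/-- Membership in the subgroup `K ⊆ N` of the polarization
`𝔨 = 𝔰 + 𝔳⁺ = span {e_{i,j} : i < j ≤ n - i + 1}`, which polarizes every `λ ∈ 𝔱^*`. -/
def InPolarization (k : borel n) : Prop :=
  (∀ i, entry k i i = 1) ∧ ∀ i j : Fin n, i < j → n ≤ i.1 + j.1 → entry k i j = 0

/-- The functions on `B` of frequency `λ`: `f(bk) = e^{iλ(log k)} f(b)` for `k ∈ K`.  This is the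
space of smooth vectors of the representation induced from the character of `K` with differential
`iλ`; on each coset of `N` it is a model of the stepwise square integrable representation attached
to `λ`.  (On `K` the functional `λ ∘ log` is `k ↦ ∑ λ_r k_{r,n-r+1}`.) -/
def HasFrequency (lam : Fin (n / 2) → ℝ) (f : smoothFn n) : Prop :=
  ∀ b k : borel n, InPolarization k →
    f.1 (b * k) = Complex.exp
      (Complex.I * ∑ r, (lam r : ℂ) * (entry k (cascadeRow r) (cascadeCol r) : ℂ)) * f.1 b

/-- `D` is Wolf's operator on `B`: the left-invariant differential operator along `N` which is
`Ad(B)`-semi-invariant of weight `δ_B` (in particular bi-invariant under `N`) and is the Fourier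
transform of the polynomial `ρ · Det_{𝔰^*}`, i.e. acts as multiplication by `ρ(λ) Det_{𝔰^*}(λ)` at
every frequency `λ ∈ 𝔱^*`. -/
structure IsWolfOperator (D : Op n) : Prop where
  leftInvariant : D ∈ leftInvariantOps n
  semiInvariant : ∀ c : borel n,
    rightTranslation c * D * rightTranslation c⁻¹ = (modularWeight c : ℂ) • D
  fourier : ∀ lam : Fin (n / 2) → ℝ, (∀ r, lam r ≠ 0) →
    ∀ f : smoothFn n, HasFrequency lam f →
      D f = ((pfaffian lam * detCenters lam : ℝ) : ℂ) • f

end DixmierPukanszky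

end

noncomputable section

namespace DixmierPukanszky

/-! ### Symmetrization in an associative algebra -/

section Symmetrization

variable {ι A : Type*} [Ring A] [Algebra ℂ A]

/-- The average of the products of a finite family over all orderings. -/
def orderAverage {m : ℕ} (a : Fin m → A) : A :=
  ((m.factorial : ℂ)⁻¹) • ∑ π : Equiv.Perm (Fin m), (List.ofFn fun k => a (π k)).prod

theorem orderAverage_comp_perm {m : ℕ} (a : Fin m → A) (σ : Equiv.Perm (Fin m)) :
    orderAverage (fun k => a (σ k)) = orderAverage a := by
  unfold orderAverage
  congr 1
  exact Fintype.sum_equiv (Equiv.mulLeft σ) _ _ fun π => rfl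

theorem exists_perm_of_map_univ_eq {m : ℕ} {f g : Fin m → ι}
    (h : Finset.univ.val.map f = Finset.univ.val.map g) :
    ∃ σ : Equiv.Perm (Fin m), ∀ k, g (σ k) = f k := by
  classical
  have hc : ∀ c, Nonempty ({k // f k = c} ≃ {k // g k = c}) := fun c => by
    refine ⟨Fintype.equivOfCardEq ?_⟩
    have := congrArg (Multiset.count c) h
    rw [Multiset.count_map, Multiset.count_map] at this
    rw [Fintype.card_subtype, Fintype.card_subtype]
    simpa only [eq_comm, Finset.card, Finset.filter] using this
  refine ⟨Equiv.ofFiberEquiv fun c => (hc c).some, fun k => ?_⟩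
  exact Equiv.ofFiberEquiv_map _ k

theorem orderAverage_eq_of_map_univ_eq {m : ℕ} (V : ι → A) {f g : Fin m → ι}
    (h : Finset.univ.val.map f = Finset.univ.val.map g) :
    orderAverage (fun k => V (f k)) = orderAverage (fun k => V (g k)) := by
  obtain ⟨σ, hσ⟩ := exists_perm_of_map_univ_eq h
  rw [← orderAverage_comp_perm (fun k => V (g k)) σ]
  simp only [hσ]

theorem map_get_univ (l : List ι) : Finset.univ.val.map l.get = (l : Multiset ι) := by
  conv_rhs => rw [← List.ofFn_get l]
  rw [Fin.univ_val_map]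

/-- The symmetrization map `ℂ[ι] → A` attached to a family `V` of elements of `A`. -/
def symMap (V : ι → A) : MvPolynomial ι ℂ →ₗ[ℂ] A :=
  (MvPolynomial.basisMonomials ι ℂ).constr ℂ fun s =>
    orderAverage fun k => V ((Finsupp.toMultiset s).toList.get k)

theorem symMap_monomial (V : ι → A) (s : ι →₀ ℕ) (c : ℂ) :
    symMap V (MvPolynomial.monomial s c) =
      c • orderAverage fun k => V ((Finsupp.toMultiset s).toList.get k) := by
  have h : MvPolynomial.monomial s c = c • MvPolynomial.basisMonomials ι ℂ s := by
    simp [MvPolynomial.smul_monomial]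
  rw [h, map_smul, symMap, Module.Basis.constr_basis]

theorem symMap_prod_X (V : ι → A) {m : ℕ} (f : Fin m → ι) :
    symMap V (∏ k, MvPolynomial.X (f k)) = orderAverage fun k => V (f k) := by
  classical
  have h : (∏ k, MvPolynomial.X (f k) : MvPolynomial ι ℂ) =
      MvPolynomial.monomial (∑ k, Finsupp.single (f k) 1) 1 := by
    rw [MvPolynomial.monomial_sum_one]
    rfl
  rw [h, symMap_monomial, one_smul]
  set t := (Finsupp.toMultiset (∑ k, Finsupp.single (f k) 1)).toList with ht
  have h1 : (t : Multiset ι) = Finset.univ.val.map f := by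
    rw [ht, Multiset.coe_toList, map_sum]
    simp only [Finsupp.toMultiset_single, one_smul]
    rw [Finset.sum, show (fun k => ({f k} : Multiset ι)) = (fun p => {p}) ∘ f from rfl,
      ← Multiset.map_map, Multiset.sum_map_singleton]
  have h2 : t.length = m := by
    have := congrArg Multiset.card h1
    simpa using this
  clear_value t
  subst h2
  exact orderAverage_eq_of_map_univ_eq V ((map_get_univ t).trans h1)

theorem prod_X_get (s : ι →₀ ℕ) :
    (∏ k, MvPolynomial.X ((Finsupp.toMultiset s).toList.get k) : MvPolynomial ι ℂ) =
      MvPolynomial.monomial s 1 := by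
  rw [← List.prod_ofFn, ← Function.comp_def MvPolynomial.X, ← List.map_ofFn, List.ofFn_get,
    ← Multiset.prod_coe, ← Multiset.map_coe, Multiset.coe_toList,
    Finsupp.toMultiset_map, Finsupp.prod_toMultiset,
    Finsupp.prod_mapDomain_index (fun _ => pow_zero _) (fun _ _ _ => pow_add _ _ _)]
  simp [MvPolynomial.monomial_eq]

/-- Symmetrization of a product of linear forms. -/
theorem symMap_prod_linear [Fintype ι] (V : ι → A) {m : ℕ} (L : Fin m → ι → ℂ) :
    symMap V (∏ k, ∑ p, L k p • MvPolynomial.X p) =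
      orderAverage fun k => ∑ p, L k p • V p := by
  classical
  let F₁ : MultilinearMap ℂ (fun _ : Fin m => ι → ℂ) A :=
    (symMap V).compMultilinearMap
      ((MultilinearMap.mkPiAlgebra ℂ (Fin m) (MvPolynomial ι ℂ)).compLinearMap
        fun _ => Fintype.linearCombination ℂ MvPolynomial.X)
  let F₂ : MultilinearMap ℂ (fun _ : Fin m => ι → ℂ) A :=
    ((m.factorial : ℂ)⁻¹) • ∑ π : Equiv.Perm (Fin m),
      ((MultilinearMap.mkPiAlgebraFin ℂ m A).compLinearMap
        fun _ => Fintype.linearCombination ℂ V).domDomCongr π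
  have h : F₁ = F₂ := by
    refine Module.Basis.ext_multilinear (fun _ => Pi.basisFun ℂ ι) fun v => ?_
    have e₁ : F₁ (fun i => Pi.basisFun ℂ ι (v i)) = symMap V (∏ k, MvPolynomial.X (v k)) := by
      simp [F₁, Fintype.linearCombination_apply, Pi.single_apply]
    have e₂ : F₂ (fun i => Pi.basisFun ℂ ι (v i)) = orderAverage fun k => V (v k) := by
      simp [F₂, orderAverage, Fintype.linearCombination_apply, Pi.single_apply]
    rw [e₁, e₂, symMap_prod_X]
  have := congrArg (fun F => F L) h
  simpa [F₁, F₂, orderAverage, Fintype.linearCombination_apply, sum_apply]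
    using this

/-- Equivariance of the symmetrization under an algebra endomorphism acting linearly on the
generators. -/
theorem map_symMap [Fintype ι] (V : ι → A) (Φ : A →ₐ[ℂ] A) (a : ι → ι → ℂ)
    (hΦ : ∀ p, Φ (V p) = ∑ q, a p q • V q) (P : MvPolynomial ι ℂ) :
    Φ (symMap V P) =
      symMap V (MvPolynomial.aeval (fun p => ∑ q, a p q • MvPolynomial.X q) P) := by
  suffices h : Φ.toLinearMap ∘ₗ symMap V = symMap V ∘ₗ
      (MvPolynomial.aeval (R := ℂ) (fun p => ∑ q, a p q • MvPolynomial.X q)).toLinearMap from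
    LinearMap.congr_fun h P
  refine (MvPolynomial.basisMonomials ι ℂ).ext fun s => ?_
  rw [MvPolynomial.coe_basisMonomials]
  dsimp only
  rw [← prod_X_get s]
  set l := (Finsupp.toMultiset s).toList
  simp only [LinearMap.comp_apply, AlgHom.toLinearMap_apply, map_prod, MvPolynomial.aeval_X]
  rw [symMap_prod_linear V (fun k => a (l.get k)), symMap_prod_X]
  simp only [orderAverage, map_smul, map_sum, map_list_prod, List.map_ofFn, Function.comp_def, hΦ]

/-! ### Reordering of words -/

variable {M : Type*} [AddCommMonoid M]

/-- The span of the words of weight `w` in the `V p` with fewer than `m` letters. -/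
def wordSpan (V : ι → A) (wt : ι → M) (w : M) (m : ℕ) : Submodule ℂ A :=
  Submodule.span ℂ {x | ∃ l : List ι, l.length < m ∧ (l.map wt).sum = w ∧ (l.map V).prod = x}

/-- The commutators of the `V p` are linear combinations of the `V z`, compatibly with weights. -/
def CommutatorsLinear (V : ι → A) (wt : ι → M) : Prop :=
  ∀ p q, V p * V q - V q * V p ∈ Submodule.span ℂ (V '' {z | wt z = wt p + wt q})

theorem mul_mem_wordSpan {V : ι → A} {wt : ι → M} {w : M} {m : ℕ} (p : ι) {x : A}
    (hx : x ∈ wordSpan V wt w m) : V p * x ∈ wordSpan V wt (wt p + w) (m + 1) := by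
  induction hx using Submodule.span_induction with
  | mem x h =>
    obtain ⟨l, hl, hw, rfl⟩ := h
    exact Submodule.subset_span ⟨p :: l, by simpa using hl, by simp [hw], by simp⟩
  | zero => simp
  | add x y _ _ hx hy => rw [mul_add]; exact add_mem hx hy
  | smul c x _ hx => rw [mul_smul_comm]; exact Submodule.smul_mem _ _ hx

theorem word_sub_word_mem_wordSpan {V : ι → A} {wt : ι → M} (h : CommutatorsLinear V wt)
    {l l' : List ι} (hl : l.Perm l') :
    (l.map V).prod - (l'.map V).prod ∈ wordSpan V wt (l.map wt).sum l.length := by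
  induction hl with
  | nil => simp
  | cons p hl ih =>
    simp only [List.map_cons, List.prod_cons, List.sum_cons, List.length_cons, ← mul_sub]
    exact mul_mem_wordSpan p ih
  | swap p q l =>
    have e : ((q :: p :: l).map V).prod - ((p :: q :: l).map V).prod =
        (V q * V p - V p * V q) * (l.map V).prod := by
      simp only [List.map_cons, List.prod_cons]; noncomm_ring
    rw [e]
    have hq := h q p
    generalize V q * V p - V p * V q = x at hq
    induction hq using Submodule.span_induction with
    | mem x hx =>
      obtain ⟨z, hz, rfl⟩ := hx
      refine Submodule.subset_span ⟨z :: l, by simp, ?_, by simp⟩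
      simp only [Set.mem_ofPred_eq] at hz
      simp [hz, add_assoc]
    | zero => simp
    | add x y _ _ hx hy => rw [add_mul]; exact add_mem hx hy
    | smul c x _ hx => rw [smul_mul_assoc]; exact Submodule.smul_mem _ _ hx
  | trans h₁ h₂ ih₁ ih₂ =>
    rw [← (h₁.map wt).sum_eq, ← h₁.length_eq] at ih₂
    simpa using add_mem ih₁ ih₂

theorem orderAverage_get_eq (V : ι → A) (l : List ι) :
    orderAverage (fun k => V (l.get k)) = ((l.length.factorial : ℂ)⁻¹) •
      ∑ π : Equiv.Perm (Fin l.length), ((List.ofFn (l.get ∘ π)).map V).prod := by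
  simp only [orderAverage, List.map_ofFn, Function.comp_def]

theorem ofFn_get_comp_perm (l : List ι) (π : Equiv.Perm (Fin l.length)) :
    (List.ofFn (l.get ∘ π)).Perm l := by
  have := Equiv.Perm.ofFn_comp_perm π l.get
  rwa [List.ofFn_get] at this

theorem word_mem_range_symMap {V : ι → A} (h : CommutatorsLinear V (0 : ι → ℕ)) (l : List ι) :
    (l.map V).prod ∈ LinearMap.range (symMap V) := by
  induction hm : l.length using Nat.strong_induction_on generalizing l with
  | _ m ih =>
  have hspan : ∀ w, wordSpan V (0 : ι → ℕ) w m ≤ LinearMap.range (symMap V) := fun w => by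
    refine Submodule.span_le.2 ?_
    rintro _ ⟨l', hl', -, rfl⟩
    exact ih _ hl' l' rfl
  have h1 : orderAverage (fun k => V (l.get k)) ∈ LinearMap.range (symMap V) :=
    ⟨_, symMap_prod_X V l.get⟩
  have h2 : (l.map V).prod - orderAverage (fun k => V (l.get k)) ∈
      LinearMap.range (symMap V) := by
    have e : (l.map V).prod - orderAverage (fun k => V (l.get k)) =
        ((l.length.factorial : ℂ)⁻¹) • ∑ π : Equiv.Perm (Fin l.length),
          ((l.map V).prod - ((List.ofFn (l.get ∘ π)).map V).prod) := by
      have h0 : (l.length.factorial : ℂ) ≠ 0 := by exact_mod_cast l.length.factorial_ne_zero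
      rw [orderAverage_get_eq, Finset.sum_sub_distrib, smul_sub, Finset.sum_const,
        Finset.card_univ, Fintype.card_perm, Fintype.card_fin, ← Nat.cast_smul_eq_nsmul ℂ,
        smul_smul, inv_mul_cancel₀ h0, one_smul]
    rw [e]
    refine Submodule.smul_mem _ _ (Submodule.sum_mem _ fun π _ => ?_)
    subst hm
    exact hspan _ (word_sub_word_mem_wordSpan h (ofFn_get_comp_perm l π).symm)
  simpa using add_mem h2 h1

theorem adjoin_le_range_symMap {V : ι → A} (h : CommutatorsLinear V (0 : ι → ℕ)) {x : A}
    (hx : x ∈ Algebra.adjoin ℂ (Set.range V)) : x ∈ LinearMap.range (symMap V) := by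
  rw [← Subalgebra.mem_toSubmodule, Algebra.adjoin_eq_span] at hx
  refine (Submodule.span_le.2 ?_ : _ ≤ LinearMap.range (symMap V)) hx
  intro y hy
  obtain ⟨l, hl, rfl⟩ := Submonoid.exists_list_of_mem_closure hy
  obtain ⟨l, rfl⟩ : l ∈ Set.range (List.map V) := by rwa [Set.range_list_map]
  exact word_mem_range_symMap h _

theorem orderAverage_mem_adjoin (V : ι → A) (l : List ι) :
    orderAverage (fun k => V (l.get k)) ∈ Algebra.adjoin ℂ (Set.range V) := by
  rw [orderAverage_get_eq]
  refine Subalgebra.smul_mem _ (Subalgebra.sum_mem _ fun π _ => ?_) _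
  refine Subalgebra.list_prod_mem _ fun x hx => ?_
  obtain ⟨p, -, rfl⟩ := List.mem_map.1 hx
  exact Algebra.subset_adjoin ⟨p, rfl⟩

theorem symMap_mem_adjoin (V : ι → A) (P : MvPolynomial ι ℂ) :
    symMap V P ∈ Algebra.adjoin ℂ (Set.range V) := by
  rw [P.as_sum, map_sum]
  refine Subalgebra.sum_mem _ fun s _ => ?_
  rw [symMap_monomial]
  exact Subalgebra.smul_mem _ (orderAverage_mem_adjoin V _) _

end Symmetrization

/-! ### Action of symmetrized polynomials on a vector -/

section Eigenvector

variable {ι S M : Type*} [AddCommGroup S] [Module ℂ S] [AddCommMonoid M]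

theorem word_apply_of_forall_eigen {V : ι → Module.End ℂ S} {χ : ι → ℂ} {f : S} (l : List ι)
    (h : ∀ p ∈ l, V p f = χ p • f) : (l.map V).prod f = (l.map χ).prod • f := by
  induction l with
  | nil => simp
  | cons p l ih =>
    simp only [List.map_cons, List.prod_cons, Module.End.mul_apply]
    rw [ih fun q hq => h q (List.mem_cons_of_mem _ hq), map_smul, h p List.mem_cons_self,
      smul_smul, mul_comm]

/-- If every word of weight `w` either contains a letter killing `f`, or has length `d` and
consists of letters of which `f` is an eigenvector, then words of weight `w` and length at most
`d` act on `f` by scalars. -/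
theorem word_apply_eq {V : ι → Module.End ℂ S} {wt : ι → M} (hV : CommutatorsLinear V wt)
    {χ : ι → ℂ} {f : S} {w : M} {d : ℕ}
    (H : ∀ l : List ι, (l.map wt).sum = w → (∃ p ∈ l, V p f = 0 ∧ χ p = 0) ∨
      (l.length = d ∧ ∀ p ∈ l, V p f = χ p • f))
    (l : List ι) (hl : (l.map wt).sum = w) (hd : l.length ≤ d) :
    (l.map V).prod f = (l.map χ).prod • f := by
  classical
  induction hm : l.length using Nat.strong_induction_on generalizing l with
  | _ m ih =>
  rcases H l hl with ⟨p, hp, hpf, hχ⟩ | ⟨-, h⟩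
  · have h0 : (l.map χ).prod = 0 := List.prod_eq_zero (hχ ▸ List.mem_map_of_mem hp)
    rw [h0, zero_smul]
    have hperm : l.Perm (l.erase p ++ [p]) :=
      (List.perm_cons_erase hp).trans (List.perm_append_singleton p _).symm
    have h1 := word_sub_word_mem_wordSpan hV hperm
    have h2 : ∀ x ∈ wordSpan V wt (l.map wt).sum l.length, x f = 0 := by
      intro x hx
      induction hx using Submodule.span_induction with
      | mem x hx =>
        obtain ⟨l', hl', hw', rfl⟩ := hx
        rw [ih l'.length (hm ▸ hl') l' (hw'.trans hl) (hl'.le.trans hd) rfl]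
        rcases H l' (hw'.trans hl) with ⟨q, hq, -, hq'⟩ | ⟨h, -⟩
        · rw [List.prod_eq_zero (hq' ▸ List.mem_map_of_mem hq), zero_smul]
        · omega
      | zero => rfl
      | add x y _ _ hx hy => rw [LinearMap.add_apply, hx, hy, add_zero]
      | smul c x _ hx => rw [LinearMap.smul_apply, hx, smul_zero]
    have h3 := h2 _ h1
    rw [LinearMap.sub_apply, sub_eq_zero] at h3
    simpa [hpf] using h3
  · exact word_apply_of_forall_eigen l h

theorem orderAverage_apply {m : ℕ} (a : Fin m → Module.End ℂ S) (f x : S)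
    (h : ∀ π : Equiv.Perm (Fin m), (List.ofFn fun k => a (π k)).prod f = x) :
    orderAverage a f = x := by
  have h0 : (m.factorial : ℂ) ≠ 0 := by exact_mod_cast m.factorial_ne_zero
  rw [orderAverage, LinearMap.smul_apply, LinearMap.sum_apply, Finset.sum_congr rfl fun π _ => h π,
    Finset.sum_const, Finset.card_univ, Fintype.card_perm, Fintype.card_fin,
    ← Nat.cast_smul_eq_nsmul ℂ, smul_smul, inv_mul_cancel₀ h0, one_smul]

theorem map_toList_prod (χ : ι → ℂ) (s : ι →₀ ℕ) :
    ((Finsupp.toMultiset s).toList.map χ).prod = MvPolynomial.eval χ (MvPolynomial.monomial s 1) := by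
  rw [← prod_X_get, map_prod, ← List.prod_ofFn]
  simp only [MvPolynomial.eval_X]
  rw [← Function.comp_def χ, ← List.map_ofFn, List.ofFn_get]

theorem map_toList_sum (wt : ι → M) (s : ι →₀ ℕ) :
    ((Finsupp.toMultiset s).toList.map wt).sum = Finsupp.weight wt s := by
  rw [← Multiset.sum_coe, ← Multiset.map_coe, Multiset.coe_toList]
  induction s using Finsupp.induction_linear with
  | zero => simp
  | add s t hs ht => rw [map_add, Multiset.map_add, Multiset.sum_add, hs, ht, map_add]
  | single p k => simp [Finsupp.weight_single, Multiset.map_nsmul, Multiset.sum_nsmul]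

theorem length_toList (s : ι →₀ ℕ) : (Finsupp.toMultiset s).toList.length = s.degree := by
  rw [Multiset.length_toList, Finsupp.card_toMultiset, Finsupp.degree]
  rfl

theorem symMap_apply_eq {V : ι → Module.End ℂ S} {wt : ι → M} (hV : CommutatorsLinear V wt)
    {χ : ι → ℂ} {f : S} {w : M} {d : ℕ}
    (H : ∀ l : List ι, (l.map wt).sum = w → (∃ p ∈ l, V p f = 0 ∧ χ p = 0) ∨
      (l.length = d ∧ ∀ p ∈ l, V p f = χ p • f))
    {P : MvPolynomial ι ℂ} (hw : P.IsWeightedHomogeneous wt w) (hd : P.totalDegree ≤ d) :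
    symMap V P f = MvPolynomial.eval χ P • f := by
  conv_lhs => rw [P.as_sum]
  conv_rhs => rw [P.as_sum]
  rw [map_sum, map_sum, LinearMap.sum_apply, Finset.sum_smul]
  refine Finset.sum_congr rfl fun s hs => ?_
  have hws := hw (MvPolynomial.mem_support_iff.1 hs)
  have hds : s.degree ≤ d := (MvPolynomial.le_totalDegree hs).trans hd
  rw [symMap_monomial, LinearMap.smul_apply, ← mul_one (P.coeff s), ← smul_eq_mul,
    ← MvPolynomial.smul_monomial, smul_eq_mul, mul_one, MvPolynomial.smul_eval, mul_smul,
    ← map_toList_prod]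
  congr 1
  set l := (Finsupp.toMultiset s).toList with hl
  refine orderAverage_apply _ _ _ fun π => ?_
  have hp := ofFn_get_comp_perm l π
  have h1 := word_apply_eq hV H (List.ofFn (l.get ∘ π))
    (by rw [(hp.map wt).sum_eq, hl, map_toList_sum, hws])
    (by rw [hp.length_eq, hl, length_toList]; exact hds)
  rw [(hp.map χ).prod_eq, List.map_ofFn] at h1
  exact h1

end Eigenvector

/-! ### Symbols of words in derivations -/

section Derivation

variable {ι S : Type*} [CommRing S] [Algebra ℂ S]

/-- The operators `V p` satisfy the Leibniz rule. -/
def IsLeibniz (V : ι → Module.End ℂ S) : Prop :=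
  ∀ p f g, V p (f * g) = f * V p g + g * V p f

theorem IsLeibniz.pow {V : ι → Module.End ℂ S} (hV : IsLeibniz V) (p : ι) (g : S) (k : ℕ) :
    V p (g ^ (k + 1)) = (k + 1 : S) * g ^ k * V p g := by
  induction k with
  | zero => simp
  | succ k ih => rw [pow_succ, hV, ih]; push_cast; ring

theorem word_pow {V : ι → Module.End ℂ S} (hV : IsLeibniz V) (g : S) (k : ℕ) (l : List ι) :
    ∃ h, (l.map V).prod (g ^ (k + l.length)) =
      ((k + l.length).descFactorial l.length : S) * (g ^ k * (l.map fun p => V p g).prod) +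
        g ^ (k + 1) * h := by
  induction l generalizing k with
  | nil => exact ⟨0, by simp⟩
  | cons p l ih =>
    obtain ⟨h, hh⟩ := ih (k + 1)
    have hc : ∀ (N : ℕ) (x : S), V p ((N : S) * x) = N * V p x := fun N x => by
      rw [← nsmul_eq_mul, map_nsmul, nsmul_eq_mul]
    refine ⟨((k + 1 + l.length).descFactorial l.length : S) *
      V p ((l.map fun p => V p g).prod) + (k + 2) * V p g * h + g * V p h, ?_⟩
    simp only [List.map_cons, List.prod_cons, Module.End.mul_apply, List.length_cons]
    rw [show k + (l.length + 1) = k + 1 + l.length by ring, hh, map_add, hc, hV, hV, hV.pow, hV.pow,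
      Nat.descFactorial_succ, show k + 1 + l.length - l.length = k + 1 by omega]
    push_cast
    ring

theorem eval_word_pow {V : ι → Module.End ℂ S} (hV : IsLeibniz V) (ev : S →ₐ[ℂ] ℂ) {g : S}
    (hg : ev g = 0) (l : List ι) {m : ℕ} (hm : l.length ≤ m) :
    ev ((l.map V).prod (g ^ m)) =
      if l.length = m then m.factorial * (l.map fun p => ev (V p g)).prod else 0 := by
  obtain ⟨k, rfl⟩ := Nat.exists_eq_add_of_le' hm
  obtain ⟨h, hh⟩ := word_pow hV g k l
  rw [hh]
  rcases k with _ | k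
  · simp [hg, Nat.descFactorial_self, map_list_prod, List.map_map, Function.comp_def]
  · simp [hg]

theorem eval_symMap_pow {V : ι → Module.End ℂ S} (hV : IsLeibniz V) (ev : S →ₐ[ℂ] ℂ) {g : S}
    (hg : ev g = 0) {P : MvPolynomial ι ℂ} {m : ℕ} (hm : P.totalDegree ≤ m) :
    ev (symMap V P (g ^ m)) = m.factorial *
      MvPolynomial.eval (fun p => ev (V p g)) (MvPolynomial.homogeneousComponent m P) := by
  conv_lhs => rw [P.as_sum]
  rw [MvPolynomial.homogeneousComponent_apply, map_sum, map_sum, LinearMap.sum_apply, map_sum,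
    Finset.sum_filter, Finset.mul_sum]
  refine Finset.sum_congr rfl fun s hs => ?_
  have hds : s.degree ≤ m := (MvPolynomial.le_totalDegree hs).trans hm
  have h0 : (s.degree.factorial : ℂ) ≠ 0 := by exact_mod_cast s.degree.factorial_ne_zero
  set ξ := fun p => ev (V p g) with hξ
  set l := (Finsupp.toMultiset s).toList with hl
  have hlen : l.length = s.degree := length_toList s
  have key : ∀ π : Equiv.Perm (Fin l.length),
      ev (((List.ofFn (l.get ∘ π)).map V).prod (g ^ m)) =
        if s.degree = m then m.factorial * MvPolynomial.eval ξ (MvPolynomial.monomial s 1) else 0 := by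
    intro π
    have hp := ofFn_get_comp_perm l π
    rw [eval_word_pow hV ev hg _ (by rw [hp.length_eq, hlen]; exact hds), (hp.map _).prod_eq,
      hp.length_eq, hlen, hl, map_toList_prod]
  rw [symMap_monomial, LinearMap.smul_apply, map_smul, ← hl, orderAverage_get_eq,
    LinearMap.smul_apply, LinearMap.sum_apply, map_smul, map_sum,
    Finset.sum_congr rfl fun π _ => key π, Finset.sum_const, Finset.card_univ,
    Fintype.card_perm, Fintype.card_fin, ← Nat.cast_smul_eq_nsmul ℂ, hlen, smul_smul, smul_smul,
    mul_assoc, inv_mul_cancel₀ h0, mul_one]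
  split_ifs
  · simp only [MvPolynomial.eval_monomial, smul_eq_mul]
    ring
  · simp

theorem symMap_injective {V : ι → Module.End ℂ S} (hV : IsLeibniz V) (ev : S →ₐ[ℂ] ℂ)
    (hg : ∀ ξ : ι → ℂ, ∃ g, ev g = 0 ∧ ∀ p, ev (V p g) = ξ p) :
    Function.Injective (symMap V) := by
  refine (injective_iff_map_eq_zero _).2 fun P hP => ?_
  have h0 : MvPolynomial.homogeneousComponent P.totalDegree P = 0 := by
    refine MvPolynomial.funext fun ξ => ?_
    obtain ⟨g, hg0, hgξ⟩ := hg ξ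
    have h := eval_symMap_pow hV ev hg0 (le_refl P.totalDegree)
    rw [hP, LinearMap.zero_apply, map_zero, funext hgξ, eq_comm, mul_eq_zero] at h
    rw [map_zero]
    exact h.resolve_left (by exact_mod_cast P.totalDegree.factorial_ne_zero)
  by_contra hne
  obtain ⟨s, hs, hsd⟩ := Finset.exists_mem_eq_sup P.support
    (MvPolynomial.support_nonempty.2 hne) fun s => s.degree
  have h1 := congrArg (MvPolynomial.coeff s) h0
  rw [MvPolynomial.coeff_homogeneousComponent, if_pos, MvPolynomial.coeff_zero] at h1
  · exact MvPolynomial.mem_support_iff.1 hs h1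
  · rw [MvPolynomial.totalDegree]
    exact hsd.symm

theorem IsLeibniz.apply_mem_pow {V : ι → Module.End ℂ S} (hV : IsLeibniz V) (I : Ideal S) (p : ι)
    (a : ℕ) {x : S} (hx : x ∈ I ^ (a + 1)) : V p x ∈ I ^ a := by
  induction a generalizing x with
  | zero => simp
  | succ a ih =>
    rw [pow_succ'] at hx
    induction hx using Submodule.mul_induction_on' with
    | mem_mul_mem i hi y hy =>
      rw [hV]
      refine add_mem ?_ (Ideal.mul_mem_right _ _ hy)
      rw [pow_succ']
      exact Ideal.mul_mem_mul hi (ih hy)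
    | add x _ y _ hx hy => rw [map_add]; exact add_mem hx hy

theorem IsLeibniz.word_mem_pow {V : ι → Module.End ℂ S} (hV : IsLeibniz V) (I : Ideal S)
    (l : List ι) (a : ℕ) {x : S} (hx : x ∈ I ^ (a + l.length)) : (l.map V).prod x ∈ I ^ a := by
  induction l generalizing a with
  | nil => simpa using hx
  | cons p l ih =>
    rw [List.map_cons, List.prod_cons, Module.End.mul_apply]
    refine hV.apply_mem_pow I p a (ih (a + 1) ?_)
    rwa [List.length_cons, show a + (l.length + 1) = a + 1 + l.length by ring] at hx

theorem IsLeibniz.symMap_prod_mem {V : ι → Module.End ℂ S} (hV : IsLeibniz V) (I : Ideal S)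
    {P : MvPolynomial ι ℂ} {k : ℕ} (hP : P.totalDegree ≤ k) {x : S} (hx : x ∈ I ^ (k + 1)) :
    symMap V P x ∈ I := by
  rw [P.as_sum, map_sum, LinearMap.sum_apply]
  refine Submodule.sum_mem _ fun s hs => ?_
  have hds : s.degree ≤ k := (MvPolynomial.le_totalDegree hs).trans hP
  rw [symMap_monomial, orderAverage_get_eq]
  set l := (Finsupp.toMultiset s).toList with hl
  have hlen : l.length = s.degree := length_toList s
  simp only [LinearMap.smul_apply, LinearMap.sum_apply]
  refine Submodule.smul_of_tower_mem _ _ (Submodule.smul_of_tower_mem _ _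
    (Submodule.sum_mem _ fun π _ => ?_))
  have h := hV.word_mem_pow I (List.ofFn (l.get ∘ π)) 1 (x := x) (Ideal.pow_le_pow_right ?_ hx)
  · simpa using h
  · simp only [List.length_ofFn]; omega

end Derivation

variable {n : ℕ}

/-! ### The vector fields on `B` -/

/-- The value at the array `x` of the linear vector field `x ↦ x e_p`. -/
def rootDirection (p : PosRoot n) (x : Fin n → Fin n → ℝ) : Fin n → Fin n → ℝ :=
  fun i j => if p.1.2 = j then x i p.1.1 else 0

theorem contDiff_rootDirection (p : PosRoot n) : ContDiff ℝ ∞ (rootDirection p) := by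
  refine contDiff_pi.2 fun i => contDiff_pi.2 fun j => ?_
  unfold rootDirection
  split_ifs
  · fun_prop
  · exact contDiff_const

theorem vectorField_apply {f : smoothFn n} {F : (Fin n → Fin n → ℝ) → ℂ}
    (hF : ContDiffOn ℝ ∞ F (posDiag n)) (hf : ∀ b, f.1 b = F (entry b)) (p : PosRoot n)
    (b : borel n) : (vectorField p f).1 b = fderiv ℝ F (entry b) (rootDirection p (entry b)) :=
  (hasDerivAt_rootExp hF hf p b).deriv

theorem isLeibniz_vectorField : IsLeibniz (vectorField (n := n)) := by
  intro p f g
  obtain ⟨F, hF, hf⟩ := f.2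
  obtain ⟨G, hG, hg⟩ := g.2
  ext b
  have h := (hasDerivAt_rootExp hF hf p b).differentiableAt.hasDerivAt.mul
    (hasDerivAt_rootExp hG hg p b).differentiableAt.hasDerivAt
  have h0 : b * rootExp p 0 = b := by
    refine Subtype.ext (Units.ext (funext fun i => funext fun j => ?_))
    exact congrFun (congrFun ((entry_mul_rootExp b p 0).trans
      (by rw [zero_smul, add_zero] : _ = entry b)) i) j
  refine h.deriv.trans ?_
  simp only [h0]
  change _ = f.1 b * _ + g.1 b * _
  rw [mul_comm (deriv _ _), add_comm]
  rfl

theorem IsLeibniz.smul {ι S : Type*} [CommRing S] [Algebra ℂ S] {V : ι → Module.End ℂ S}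
    (hV : IsLeibniz V) (c : ℂ) : IsLeibniz fun p => c • V p := by
  intro p f g
  simp only [LinearMap.smul_apply, hV p f g, smul_add, mul_smul_comm]

theorem commutator_vectorField (p q : PosRoot n) :
    vectorField p * vectorField q - vectorField q * vectorField p =
      (if h : p.1.2 = q.1.1 then vectorField ⟨(p.1.1, q.1.2), p.2.trans (h ▸ q.2)⟩ else 0) -
      (if h : q.1.2 = p.1.1 then vectorField ⟨(q.1.1, p.1.2), q.2.trans (h ▸ p.2)⟩ else 0) := by
  refine LinearMap.ext fun f => Subtype.ext (funext fun b => ?_)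
  obtain ⟨F, hF, hf⟩ := f.2
  have hb := (isOpen_posDiag n).mem_nhds (entry_mem_posDiag b)
  have hF' : ContDiffAt ℝ ∞ F (entry b) := hF.contDiffAt hb
  have hdF : ContDiffOn ℝ ∞ (fderiv ℝ F) (posDiag n) :=
    hF.fderiv_of_isOpen (isOpen_posDiag n) (by simp)
  have hsymm := hF'.isSymmSndFDerivAt (by simpa using ENat.LEInfty.out)
  have key : ∀ p q : PosRoot n, (vectorField p (vectorField q f)).1 b =
      fderiv ℝ (fderiv ℝ F) (entry b) (rootDirection p (entry b)) (rootDirection q (entry b)) +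
        fderiv ℝ F (entry b) (rootDirection q (rootDirection p (entry b))) := by
    intro p q
    have hG : ContDiffOn ℝ ∞ (fun x => fderiv ℝ F x (rootDirection q x)) (posDiag n) :=
      hdF.clm_apply (contDiff_rootDirection q).contDiffOn
    rw [vectorField_apply hG (fun b => vectorField_apply hF hf q b)]
    have h1 : HasFDerivAt (fderiv ℝ F) (fderiv ℝ (fderiv ℝ F) (entry b)) (entry b) :=
      ((hdF.contDiffAt hb).differentiableAt (by simp)).hasFDerivAt
    let Lq : (Fin n → Fin n → ℝ) →ₗ[ℝ] (Fin n → Fin n → ℝ) :=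
      { toFun := rootDirection q
        map_add' := fun x y => by
          funext i j; simp only [rootDirection, Pi.add_apply]; split_ifs <;> simp
        map_smul' := fun c x => by
          funext i j
          simp only [rootDirection, Pi.smul_apply, RingHom.id_apply]; split_ifs <;> simp }
    have h2 : HasFDerivAt (rootDirection q) (LinearMap.toContinuousLinearMap Lq) (entry b) :=
      (LinearMap.toContinuousLinearMap Lq).hasFDerivAt
    rw [(h1.clm_apply h2).fderiv]
    simp [Lq, add_comm]
  have hdir : ∀ p q : PosRoot n, fderiv ℝ F (entry b) (rootDirection q (rootDirection p (entry b))) =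
      ((if h : p.1.2 = q.1.1 then vectorField ⟨(p.1.1, q.1.2), p.2.trans (h ▸ q.2)⟩ else 0 : Op n)
        f).1 b := by
    intro p q
    split_ifs with h
    · rw [vectorField_apply hF hf]
      congr 1
      funext i j
      simp only [rootDirection, if_pos h]
    · have : rootDirection q (rootDirection p (entry b)) = 0 := by
        funext i j
        simp [rootDirection, h]
      rw [this, map_zero]
      rfl
  change (vectorField p (vectorField q f)).1 b - (vectorField q (vectorField p f)).1 b = _ - _
  rw [key, key, hdir, hdir, hsymm.eq]
  ring

theorem CommutatorsLinear.smul {ι A M : Type*} [Ring A] [Algebra ℂ A] [AddCommMonoid M]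
    {V : ι → A} {wt : ι → M} (h : CommutatorsLinear V wt) {c : ℂ} (hc : c ≠ 0) :
    CommutatorsLinear (fun p => c • V p) wt := by
  intro p q
  have e : (c • V p) * (c • V q) - (c • V q) * (c • V p) = (c * c) • (V p * V q - V q * V p) := by
    rw [smul_mul_smul_comm, smul_mul_smul_comm, smul_sub]
  dsimp only
  rw [e]
  refine Submodule.smul_mem _ _ ((Submodule.span_le.2 ?_ : _ ≤ _) (h p q))
  rintro _ ⟨z, hz, rfl⟩
  have := Submodule.smul_mem _ c⁻¹ (Submodule.subset_span (R := ℂ)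
    (Set.mem_image_of_mem (fun p => c • V p) hz))
  rw [SetLike.mem_coe]
  simpa only [smul_smul, inv_mul_cancel₀ hc, one_smul] using this

theorem commutatorsLinear_vectorField {M : Type*} [AddCommMonoid M] {wt : PosRoot n → M}
    (hwt : ∀ p q z : PosRoot n, p.1.2 = q.1.1 → z.1 = (p.1.1, q.1.2) → wt z = wt p + wt q) :
    CommutatorsLinear vectorField wt := by
  intro p q
  rw [commutator_vectorField]
  refine Submodule.sub_mem (Submodule.span ℂ (vectorField '' {z | wt z = wt p + wt q})) ?_ ?_
  · split_ifs with h
    · exact Submodule.subset_span ⟨_, hwt p q _ h rfl, rfl⟩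
    · exact Submodule.zero_mem _
  · split_ifs with h
    · exact Submodule.subset_span ⟨_, (hwt q p _ h rfl).trans (add_comm _ _), rfl⟩
    · exact Submodule.zero_mem _

theorem sum_posRoot {M : Type*} [AddCommMonoid M] (h : Fin n → Fin n → M) :
    ∑ q : PosRoot n, h q.1.1 q.1.2 = ∑ i, ∑ j, if i < j then h i j else 0 := by
  rw [← Fintype.sum_prod_type' (f := fun i j => if i < j then h i j else 0), ← Finset.sum_filter]
  exact (Finset.sum_subtype _ (by simp) fun x : Fin n × Fin n => h x.1 x.2).symm

theorem entry_mul (b c : borel n) (i j : Fin n) :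
    entry (b * c) i j = ∑ k, entry b i k * entry c k j := rfl

theorem entry_eq_zero (b : borel n) {i j : Fin n} (h : j < i) : entry b i j = 0 := b.2.1 i j h

theorem entry_mul_diag (b c : borel n) (i : Fin n) :
    entry (b * c) i i = entry b i i * entry c i i := by
  rw [entry_mul, Finset.sum_eq_single i]
  · intro k _ hk
    rcases lt_or_gt_of_ne hk with hk | hk
    · rw [entry_eq_zero b hk, zero_mul]
    · rw [entry_eq_zero c hk, mul_zero]
  · simp

theorem entry_one (i j : Fin n) : entry (1 : borel n) i j = if i = j then 1 else 0 :=
  Matrix.one_apply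

/-- The coefficients of `Ad(c)` on `𝔫`: `c e_p c⁻¹ = ∑ adCoeff c p q • e_q`. -/
def adCoeff (c : borel n) (p q : PosRoot n) : ℝ := entry c q.1.1 p.1.1 * entry c⁻¹ p.1.2 q.1.2

theorem conj_vectorField (c : borel n) (p : PosRoot n) :
    rightTranslation c * vectorField p * rightTranslation c⁻¹ =
      ∑ q, (adCoeff c p q : ℂ) • vectorField q := by
  refine LinearMap.ext fun f => Subtype.ext (funext fun b => ?_)
  obtain ⟨F, hF, hf⟩ := f.2
  have hd : DifferentiableAt ℝ F (entry b) :=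
    (hF.contDiffAt ((isOpen_posDiag n).mem_nhds (entry_mem_posDiag b))).differentiableAt
      (by simp)
  set W : Fin n → Fin n → ℝ := ∑ q, adCoeff c p q • rootDirection q (entry b) with hW
  have hcurve : ∀ t : ℝ, entry (b * c * rootExp p t * c⁻¹) = entry b + t • W := by
    intro t
    funext i j
    have h1 : entry (b * c * rootExp p t * c⁻¹) i j =
        entry b i j + t * (entry (b * c) i p.1.1 * entry c⁻¹ p.1.2 j) := by
      rw [entry_mul, entry_mul_rootExp]
      simp only [Pi.add_apply, Pi.smul_apply, add_mul, Finset.sum_add_distrib, ← entry_mul,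
        mul_inv_cancel_right, smul_eq_mul]
      congr 1
      rw [Finset.sum_eq_single p.1.2]
      · simp [mul_assoc]
      · intro k _ hk
        rw [if_neg hk.symm]; simp
      · simp
    rw [h1, Pi.add_apply, Pi.add_apply, Pi.smul_apply, Pi.smul_apply, smul_eq_mul, hW,
      Finset.sum_apply, Finset.sum_apply]
    congr 2
    simp only [Pi.smul_apply, rootDirection, adCoeff, smul_eq_mul]
    rw [sum_posRoot (fun k l => entry c k p.1.1 * entry c⁻¹ p.1.2 l *
      if l = j then entry b i k else 0), entry_mul, Finset.sum_mul]
    refine Finset.sum_congr rfl fun k _ => ?_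
    rw [Finset.sum_eq_single j]
    · rw [if_pos rfl]
      split_ifs with hkj
      · ring
      · rcases le_or_gt k p.1.1 with hk | hk
        · rw [entry_eq_zero c⁻¹ (show j < p.1.2 from (not_lt.1 hkj).trans_lt (hk.trans_lt p.2))]
          ring
        · rw [entry_eq_zero c hk]; ring
    · intro l _ hl
      rw [if_neg hl]; simp
    · simp
  have h1 : HasDerivAt (fun t : ℝ => entry b + t • W) W 0 := by
    simpa using ((hasDerivAt_id (0 : ℝ)).smul_const W).const_add (entry b)
  have h2 : HasFDerivAt F (fderiv ℝ F (entry b)) (entry b + (0 : ℝ) • W) := by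
    simpa using hd.hasFDerivAt
  have h3 := h2.comp_hasDerivAt (0 : ℝ) h1
  have h4 : HasDerivAt (fun t : ℝ => f.1 (b * c * rootExp p t * c⁻¹))
      (fderiv ℝ F (entry b) W) 0 := by
    refine h3.congr_of_eventuallyEq (Filter.Eventually.of_forall fun t => ?_)
    simp only [Function.comp, hf, hcurve]
  refine h4.deriv.trans ?_
  rw [hW, map_sum, LinearMap.sum_apply, AddSubmonoidClass.coe_finsetSum, Finset.sum_apply]
  refine Finset.sum_congr rfl fun q _ => ?_
  rw [map_smul, ← vectorField_apply hF hf]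
  rfl

/-- Conjugation by `R_c`, as an algebra endomorphism of the operators on `C^∞(B)`. -/
def conjTranslation (c : borel n) : Op n →ₐ[ℂ] Op n where
  toFun D := rightTranslation c * D * rightTranslation c⁻¹
  map_one' := by
    refine LinearMap.ext fun f => Subtype.ext (funext fun b => ?_)
    exact congrArg f.1 (mul_inv_cancel_right b c)
  map_mul' D E := by
    have h : rightTranslation c⁻¹ * rightTranslation c = 1 := by
      refine LinearMap.ext fun f => Subtype.ext (funext fun b => ?_)
      exact congrArg f.1 (inv_mul_cancel_right b c)
    calc _ = rightTranslation c * D * 1 * E * rightTranslation c⁻¹ := by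
          rw [mul_one, mul_assoc (rightTranslation c) D E]
      _ = _ := by rw [← h]; noncomm_ring
  map_zero' := by simp
  map_add' D E := by noncomm_ring
  commutes' a := by
    refine LinearMap.ext fun f => Subtype.ext (funext fun b => ?_)
    exact congrArg (fun x => a * f.1 x) (mul_inv_cancel_right b c)

/-! ### Test functions -/

/-- Evaluation at a point of `B`. -/
def evalAt (b : borel n) : smoothFn n →ₐ[ℂ] ℂ :=
  (Pi.evalAlgHom ℂ (fun _ : borel n => ℂ) b).comp (smoothFn n).val

/-- The function `b ↦ ∑ ξ_p b_p`. -/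
def linearFn (ξ : PosRoot n → ℂ) : smoothFn n :=
  ⟨fun b => ∑ p, ξ p * (entry b p.1.1 p.1.2 : ℂ), fun x => ∑ p, ξ p * (x p.1.1 p.1.2 : ℂ), by
    refine ContDiff.contDiffOn (ContDiff.sum fun p _ => contDiff_const.mul ?_)
    exact Complex.ofRealCLM.contDiff.comp (by fun_prop), fun _ => rfl⟩

theorem evalAt_one_linearFn (ξ : PosRoot n → ℂ) : evalAt 1 (linearFn ξ) = 0 := by
  refine Finset.sum_eq_zero fun p _ => ?_
  rw [entry_one, if_neg p.2.ne]; simp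

theorem entry_rootExp (p : PosRoot n) (t : ℝ) (i j : Fin n) :
    entry (rootExp p t) i j = (if i = j then 1 else 0) + if p.1.1 = i ∧ p.1.2 = j then t else 0 := by
  rw [← one_mul (rootExp p t), entry_mul_rootExp]
  simp only [Pi.add_apply, Pi.smul_apply, entry_one, smul_eq_mul, mul_ite, mul_zero, mul_one]
  congr 1
  by_cases h : p.1.2 = j <;> by_cases h' : p.1.1 = i <;> simp [h, h', eq_comm (a := i)]

theorem evalAt_one_vectorField_linearFn (ξ : PosRoot n → ℂ) (p : PosRoot n) :
    evalAt 1 (vectorField p (linearFn ξ)) = ξ p := by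
  have h : ∀ t : ℝ, (linearFn ξ).1 (1 * rootExp p t) = t * ξ p := by
    intro t
    change ∑ q : PosRoot n, ξ q * (entry (1 * rootExp p t) q.1.1 q.1.2 : ℂ) = _
    rw [one_mul, Finset.sum_eq_single p]
    · rw [entry_rootExp, if_neg p.2.ne]; simp [mul_comm]
    · intro q _ hq
      rw [entry_rootExp, if_neg q.2.ne, if_neg fun h => hq (Subtype.ext (Prod.ext h.1.symm h.2.symm))]
      simp
    · simp
  change deriv (fun t : ℝ => (linearFn ξ).1 (1 * rootExp p t)) 0 = _
  simp only [h]
  have := ((hasDerivAt_id (0 : ℝ)).ofReal_comp).mul_const (ξ p)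
  simpa using this.deriv

/-- The element of `𝔰^* ⊆ 𝔫^*` with coordinates `λ`. -/
def centerPoint (lam : Fin (n / 2) → ℝ) (p : PosRoot n) : ℝ :=
  ∑ r, if p.1.1 = cascadeRow r ∧ p.1.2 = cascadeCol r then lam r else 0

theorem vectorField_apply_of_hasFrequency {lam : Fin (n / 2) → ℝ} {f : smoothFn n}
    (hf : HasFrequency lam f) {p : PosRoot n} (hp : p.1.1.1 + p.1.2.1 < n) :
    vectorField p f = (Complex.I * centerPoint lam p) • f := by
  refine Subtype.ext (funext fun b => ?_)
  have hk : ∀ t, InPolarization (rootExp p t) := fun t => by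
    refine ⟨fun i => ?_, fun i j hij hn => ?_⟩
    · rw [entry_rootExp, if_pos rfl, if_neg, add_zero]
      rintro ⟨rfl, h⟩
      exact p.2.ne h.symm
    · rw [entry_rootExp, if_neg hij.ne, if_neg, add_zero]
      rintro ⟨rfl, rfl⟩
      omega
  have h : ∀ t : ℝ, f.1 (b * rootExp p t) =
      Complex.exp (t * (Complex.I * centerPoint lam p)) * f.1 b := by
    intro t
    rw [hf b _ (hk t)]
    congr 2
    rw [mul_left_comm]
    congr 1
    rw [centerPoint]
    push_cast
    rw [Finset.mul_sum]
    refine Finset.sum_congr rfl fun r _ => ?_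
    have hr : cascadeRow r ≠ cascadeCol r := by
      intro h
      have := congrArg Fin.val h
      simp only [cascadeCol, cascadeRow, Fin.val_rev] at this
      have := r.2
      omega
    rw [entry_rootExp, if_neg hr]
    split_ifs <;> simp [mul_comm]
  change deriv (fun t : ℝ => f.1 (b * rootExp p t)) 0 = _
  simp only [h]
  have := ((((hasDerivAt_id (0 : ℝ)).ofReal_comp).mul_const
    (Complex.I * centerPoint lam p)).cexp).mul_const (f.1 b)
  refine this.deriv.trans ?_
  simp

/-- A function of frequency `λ`. -/
def frequencyFn (lam : Fin (n / 2) → ℝ) : smoothFn n :=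
  ⟨fun b => Complex.exp (Complex.I * ((∑ r, lam r * (entry b (cascadeRow r) (cascadeCol r) /
      entry b (cascadeRow r) (cascadeRow r)) : ℝ) : ℂ)),
    fun x => Complex.exp (Complex.I * ((∑ r, lam r * (x (cascadeRow r) (cascadeCol r) /
      x (cascadeRow r) (cascadeRow r)) : ℝ) : ℂ)), by
    refine ContDiffOn.cexp (contDiffOn_const.mul (Complex.ofRealCLM.contDiff.comp_contDiffOn
      (f := fun x : Fin n → Fin n → ℝ => ∑ r, lam r * (x (cascadeRow r) (cascadeCol r) /
        x (cascadeRow r) (cascadeRow r))) (ContDiffOn.sum fun r _ => contDiffOn_const.mul (ContDiffOn.div ?_ ?_ fun x hx => ?_))))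
    · exact ContDiff.contDiffOn (by fun_prop)
    · exact ContDiff.contDiffOn (by fun_prop)
    · exact (hx _).ne', fun _ => rfl⟩

theorem frequencyFn_apply_ne_zero (lam : Fin (n / 2) → ℝ) (b : borel n) :
    (frequencyFn lam).1 b ≠ 0 :=
  Complex.exp_ne_zero _

theorem hasFrequency_frequencyFn (lam : Fin (n / 2) → ℝ) :
    HasFrequency lam (frequencyFn lam) := by
  intro b k hk
  change Complex.exp _ = _ * Complex.exp _
  rw [← Complex.exp_add, ← mul_add]
  congr 2
  rw [Complex.ofReal_sum, Complex.ofReal_sum, ← Finset.sum_add_distrib]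
  refine Finset.sum_congr rfl fun r _ => ?_
  norm_cast
  rw [← mul_add]
  congr 1
  have hb : entry b (cascadeRow r) (cascadeRow r) ≠ 0 := (entry_mem_posDiag b _).ne'
  have hcol : (cascadeCol r).1 = n - 1 - r.1 := by
    simp only [cascadeCol, cascadeRow, Fin.val_rev]; omega
  have hrow : (cascadeRow r).1 = r.1 := rfl
  have hr := r.2
  have hne : cascadeRow r ≠ cascadeCol r := fun h => by
    have := congrArg Fin.val h
    omega
  have h1 : entry (b * k) (cascadeRow r) (cascadeCol r) =
      entry b (cascadeRow r) (cascadeRow r) * entry k (cascadeRow r) (cascadeCol r) +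
        entry b (cascadeRow r) (cascadeCol r) := by
    rw [entry_mul, Fintype.sum_eq_add _ _ hne, hk.1 (cascadeCol r), mul_one]
    rintro j ⟨hj1, hj2⟩
    rcases lt_or_gt_of_ne hj1 with h | h
    · rw [entry_eq_zero b h, zero_mul]
    · rcases lt_or_gt_of_ne hj2 with h' | h'
      · rw [hk.2 j _ h', mul_zero]
        have := Fin.lt_def.1 h
        omega
      · rw [entry_eq_zero k h', mul_zero]
  rw [h1, entry_mul_diag, hk.1, mul_one]
  field_simp

/-! ### Lower-left corner minors -/

section Corner

variable {R : Type*} [CommRing R]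

/-- The lower-left `r × r` corner of an `n × n` matrix. -/
def corner {A : Type*} {r : ℕ} (hr : r ≤ n) (M : Matrix (Fin n) (Fin n) A) :
    Matrix (Fin r) (Fin r) A :=
  M.submatrix (fun i => ⟨n - r + i.1, by omega⟩) (fun j => ⟨j.1, by omega⟩)

theorem coeff_prod_of_natDegree_le_apply {ι : Type*} (s : Finset ι) (f : ι → Polynomial R)
    (e : ι → ℕ) (h : ∀ i ∈ s, (f i).natDegree ≤ e i) :
    (∏ i ∈ s, f i).coeff (∑ i ∈ s, e i) = ∏ i ∈ s, (f i).coeff (e i) := by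
  classical
  induction s using Finset.induction_on with
  | empty => simp
  | insert a s ha ih =>
    have h' : ∀ i ∈ s, (f i).natDegree ≤ e i := fun i hi => h i (Finset.mem_insert_of_mem hi)
    rw [Finset.prod_insert ha, Finset.sum_insert ha, Finset.prod_insert ha,
      Polynomial.coeff_mul_add_eq_of_natDegree_le (h a (Finset.mem_insert_self a s))
        ((Polynomial.natDegree_prod_le s f).trans (Finset.sum_le_sum h')), ih h']

theorem coeff_det_of_natDegree_le {m : Type*} [Fintype m] [DecidableEq m]
    (M : Matrix m m (Polynomial R)) (e : m → ℕ) (h : ∀ i j, (M i j).natDegree ≤ e j) :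
    M.det.coeff (∑ j, e j) = (Matrix.of fun i j => (M i j).coeff (e j)).det := by
  rw [Matrix.det_apply, Matrix.det_apply, Polynomial.finsetSum_coeff]
  refine Finset.sum_congr rfl fun σ _ => ?_
  rw [Polynomial.coeff_smul, coeff_prod_of_natDegree_le_apply _ _ _ fun i _ => h (σ i) i]
  rfl

/-- The top coefficient in `η` of the chopped determinant of `Y - η` is, up to sign, the corner
minor. -/
theorem coeff_det_chop (r : ℕ) (hr : 2 * r ≤ n) (Y : Matrix (Fin n) (Fin n) R) :
    ∃ ε : ℤˣ, (n = 2 * r → ε = 1) ∧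
      (chop (Y.map Polynomial.C - Matrix.scalar (Fin n) (Polynomial.X : Polynomial R)) r).det.coeff
        (n - 2 * r) = (ε : ℤ) • (corner (by omega : r ≤ n) Y).det := by
  classical
  set M := chop (Y.map Polynomial.C - Matrix.scalar (Fin n) (Polynomial.X : Polynomial R)) r with hM
  have hMe : ∀ a j, M a j = Polynomial.C (Y ⟨a.1 + r, by omega⟩ ⟨j.1, by omega⟩) -
      if a.1 + r = j.1 then Polynomial.X else 0 := by
    intro a j
    simp only [hM, chop, Matrix.submatrix_apply, Matrix.sub_apply, Matrix.map_apply,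
      Matrix.scalar_apply, Matrix.diagonal_apply, Fin.mk.injEq]
  let e : Fin (n - r) → ℕ := fun j => if j.1 < r then 0 else 1
  let γ : Fin r ⊕ Fin (n - 2 * r) ≃ Fin (n - r) := finSumFinEquiv.trans (finCongr (by omega))
  let ρ : Fin r ⊕ Fin (n - 2 * r) ≃ Fin (n - r) :=
    (Equiv.sumComm _ _).trans (finSumFinEquiv.trans (finCongr (by omega)))
  have hγl : ∀ i, (γ (Sum.inl i)).1 = i.1 := fun i => rfl
  have hγr : ∀ i, (γ (Sum.inr i)).1 = r + i.1 := fun i => rfl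
  have hρl : ∀ i, (ρ (Sum.inl i)).1 = n - 2 * r + i.1 := fun i => rfl
  have hρr : ∀ i, (ρ (Sum.inr i)).1 = i.1 := fun i => rfl
  have he : ∑ j, e j = n - 2 * r := by
    rw [← γ.sum_comp, Fintype.sum_sum_type]
    have h1 : ∀ i, e (γ (Sum.inl i)) = 0 := fun i => if_pos (by rw [hγl]; exact i.2)
    have h2 : ∀ i, e (γ (Sum.inr i)) = 1 := fun i => if_neg (by rw [hγr]; omega)
    simp [h1, h2]
  have hdeg : ∀ a j, (M a j).natDegree ≤ e j := by
    intro a j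
    rw [hMe]
    by_cases hj : j.1 < r
    · rw [if_neg (by omega), sub_zero, Polynomial.natDegree_C]
      exact Nat.zero_le _
    · simp only [e, if_neg hj]
      refine (Polynomial.natDegree_sub_le _ _).trans (max_le ?_ ?_)
      · rw [Polynomial.natDegree_C]; exact Nat.zero_le _
      · split_ifs
        · exact Polynomial.natDegree_X_le
        · simp
  set N : Matrix (Fin (n - r)) (Fin (n - r)) R := Matrix.of fun a j => (M a j).coeff (e j) with hN
  have hcoeff : M.det.coeff (n - 2 * r) = N.det := by
    rw [← he, coeff_det_of_natDegree_le M e hdeg]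
  have hblock : N.submatrix ρ γ = Matrix.fromBlocks (corner (by omega : r ≤ n) Y) 0
      ((N.submatrix ρ γ).toBlocks₂₁) (-1) := by
    rw [← Matrix.fromBlocks_toBlocks (N.submatrix ρ γ)]
    refine Matrix.fromBlocks_inj.2 ⟨?_, ?_, rfl, ?_⟩
    · ext i j
      have hj : (γ (Sum.inl j)).1 < r := by rw [hγl]; exact j.2
      simp only [Matrix.toBlocks₁₁, Matrix.of_apply, Matrix.submatrix_apply, hN, hMe, e, if_pos hj,
        corner]
      rw [if_neg (by omega), sub_zero, Polynomial.coeff_C_zero]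
      congr 1
      apply Fin.ext
      simp only [hρl]
      omega
    · ext i j
      have hj : ¬ (γ (Sum.inr j)).1 < r := by rw [hγr]; omega
      simp only [Matrix.toBlocks₁₂, Matrix.of_apply, Matrix.submatrix_apply, hN, hMe, e, if_neg hj]
      rw [if_neg (by rw [hρl, hγr]; omega), sub_zero, Polynomial.coeff_C_of_ne_zero one_ne_zero]
      rfl
    · ext i j
      have hj : ¬ (γ (Sum.inr j)).1 < r := by rw [hγr]; omega
      simp only [Matrix.toBlocks₂₂, Matrix.of_apply, Matrix.submatrix_apply, hN, hMe, e, if_neg hj]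
      rw [Polynomial.coeff_sub, Polynomial.coeff_C_of_ne_zero one_ne_zero, zero_sub, Matrix.neg_apply,
        Matrix.one_apply]
      congr 1
      have : (ρ (Sum.inr i)).1 + r = (γ (Sum.inr j)).1 ↔ i = j := by
        rw [hρr, hγr, Fin.ext_iff]; omega
      simp only [this]
      split_ifs <;> simp
  have hdet : (N.submatrix ρ γ).det = (corner (by omega : r ≤ n) Y).det * (-1) ^ (n - 2 * r) := by
    rw [hblock, Matrix.det_fromBlocks_zero₁₂, Matrix.det_neg, Matrix.det_one, mul_one,
      Fintype.card_fin]
  have hperm : (N.submatrix ρ γ).det =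
      ((Equiv.Perm.sign (γ.symm.trans ρ) : ℤ) : R) * N.det := by
    rw [← Matrix.det_permute, ← Matrix.det_submatrix_equiv_self γ]
    congr 1
    ext i j
    simp [Matrix.submatrix_apply]
  refine ⟨Equiv.Perm.sign (γ.symm.trans ρ) * (-1) ^ (n - 2 * r), fun h => ?_, ?_⟩
  · have hE : IsEmpty (Fin (n - 2 * r)) := by rw [h, Nat.sub_self]; infer_instance
    have hργ : ρ = γ := by
      ext x
      rcases x with i | i
      · rw [hρl, hγl]; omega
      · exact hE.elim i
    rw [hργ, Equiv.symm_trans_self, h, Nat.sub_self]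
    simp
  · rw [hcoeff]
    have h1 : N.det = ((Equiv.Perm.sign (γ.symm.trans ρ) : ℤ) : R) * (N.submatrix ρ γ).det := by
      rw [hperm, ← mul_assoc, ← Int.cast_mul, ← Units.val_mul, Int.units_mul_self]
      simp
    rw [h1, hdet, zsmul_eq_mul]
    push_cast
    ring

theorem det_corner_mul_mul {r : ℕ} (hr : r ≤ n) {A C : Matrix (Fin n) (Fin n) R}
    (hA : ∀ i j, j < i → A i j = 0) (hC : ∀ i j, j < i → C i j = 0)
    (Y : Matrix (Fin n) (Fin n) R) :
    (corner hr (A * Y * C)).det = (∏ i : Fin r, A ⟨n - r + i.1, by omega⟩ ⟨n - r + i.1, by omega⟩) *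
      (corner hr Y).det * ∏ j : Fin r, C ⟨j.1, by omega⟩ ⟨j.1, by omega⟩ := by
  let lo : Fin r → Fin n := fun i => ⟨n - r + i.1, by omega⟩
  let up : Fin r → Fin n := fun j => ⟨j.1, by omega⟩
  have hlo : Function.Injective lo := fun i j h => by
    have := congrArg Fin.val h; simp only [lo] at this; exact Fin.ext (by omega)
  have hup : Function.Injective up := fun i j h => by
    have := congrArg Fin.val h; simp only [up] at this; exact Fin.ext (by omega)
  have h : corner hr (A * Y * C) = A.submatrix lo lo * corner hr Y * C.submatrix up up := by
    have h1 : (A * Y * C).submatrix lo up = (A * Y).submatrix lo up * C.submatrix up up := by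
      ext i j
      rw [Matrix.submatrix_apply, Matrix.mul_apply, Matrix.mul_apply]
      refine (Finset.sum_of_injOn up hup.injOn (by simp) (fun k _ hk => ?_) fun k _ => rfl).symm
      rw [hC k (up j), mul_zero]
      by_contra hkj
      refine hk ⟨⟨k.1, ?_⟩, by simp, rfl⟩
      have := Fin.le_def.1 (not_lt.1 hkj)
      simp only [up] at this
      omega
    have h2 : (A * Y).submatrix lo up = A.submatrix lo lo * Y.submatrix lo up := by
      ext i j
      rw [Matrix.submatrix_apply, Matrix.mul_apply, Matrix.mul_apply]
      refine (Finset.sum_of_injOn lo hlo.injOn (by simp) (fun k _ hk => ?_) fun k _ => rfl).symm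
      rw [hA (lo i) k, zero_mul]
      by_contra hki
      have := Fin.le_def.1 (not_lt.1 hki)
      simp only [lo] at this
      refine hk ⟨⟨k.1 - (n - r), by omega⟩, by simp, Fin.ext ?_⟩
      simp only [lo]
      omega
    rw [corner, h1, h2]
    rfl
  have h1 : (A.submatrix lo lo).IsUpperTriangular := fun i j hij => by
    refine hA _ _ (Fin.lt_def.2 ?_)
    have := Fin.lt_def.1 hij
    simp only [lo, id] at this ⊢
    omega
  have h2 : (C.submatrix up up).IsUpperTriangular := fun i j hij => by
    refine hC _ _ (Fin.lt_def.2 ?_)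
    have := Fin.lt_def.1 hij
    simp only [up, id] at this ⊢
    omega
  rw [h, Matrix.det_mul, Matrix.det_mul, Matrix.det_of_isUpperTriangular h1,
    Matrix.det_of_isUpperTriangular h2]
  rfl

end Corner

/-- The strictly lower triangular matrix with coordinates `ξ`. -/
def lowerMatrix {R : Type*} [Zero R] (ξ : PosRoot n → R) : Matrix (Fin n) (Fin n) R :=
  Matrix.of fun i j => if h : j < i then ξ ⟨(j, i), h⟩ else 0

/-- The lower-left corner minor as a polynomial function on `𝔫₋`. -/
def cornerMinor (n r : ℕ) (hr : r ≤ n) : SymAlg n := (corner hr (genericLower n)).det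

theorem eval_cornerMinor {r : ℕ} (hr : 2 * r ≤ n) (Y : Matrix (Fin n) (Fin n) ℝ) :
    MvPolynomial.eval (fun p => Y p.1.2 p.1.1) (cornerMinor n r (by omega)) =
      (corner (by omega : r ≤ n) Y).det := by
  rw [cornerMinor, RingHom.map_det]
  congr 1
  ext i j
  simp only [RingHom.mapMatrix_apply, Matrix.map_apply, corner, Matrix.submatrix_apply,
    genericLower, Matrix.of_apply]
  rw [dif_pos (Fin.lt_def.2 (by simp only; omega)), MvPolynomial.eval_X]

theorem det_isWeightedHomogeneous {σ M m R : Type*} [AddCommMonoid M] [CommRing R] [Fintype m]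
    [DecidableEq m] {wt : σ → M} {A : Matrix m m (MvPolynomial σ R)} {w : m → m → M} {W : M}
    (hA : ∀ i j, (A i j).IsWeightedHomogeneous wt (w i j))
    (hw : ∀ τ : Equiv.Perm m, ∑ i, w (τ i) i = W) : A.det.IsWeightedHomogeneous wt W := by
  rw [Matrix.det_apply]
  refine MvPolynomial.IsWeightedHomogeneous.sum _ _ _ fun τ _ => ?_
  have h := MvPolynomial.IsWeightedHomogeneous.prod Finset.univ (fun i => A (τ i) i)
    (fun i => w (τ i) i) fun i _ => hA (τ i) i
  rw [hw τ] at h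
  rcases Int.units_eq_one_or (Equiv.Perm.sign τ) with h1 | h1
  · rwa [h1, one_smul]
  · rw [h1, Units.neg_smul, one_smul]
    exact h.neg

/-- The weight of `e_{i,j}` under the diagonal torus. -/
def rootWeight (p : PosRoot n) : Fin n → ℤ := Pi.single p.1.1 1 - Pi.single p.1.2 1

theorem cornerMinor_isWeightedHomogeneous {r : ℕ} (hr : 2 * r ≤ n) :
    (cornerMinor n r (by omega)).IsWeightedHomogeneous rootWeight
      (∑ j : Fin r, (Pi.single (⟨j.1, by omega⟩ : Fin n) 1 -
        Pi.single (⟨n - r + j.1, by omega⟩ : Fin n) 1)) := by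
  refine det_isWeightedHomogeneous (w := fun i j => Pi.single (⟨j.1, by omega⟩ : Fin n) 1 -
        Pi.single (⟨n - r + i.1, by omega⟩ : Fin n) 1) (fun i j => ?_) fun τ => ?_
  · simp only [corner, Matrix.submatrix_apply, genericLower, Matrix.of_apply]
    rw [dif_pos (Fin.lt_def.2 (by simp only; omega))]
    exact MvPolynomial.isWeightedHomogeneous_X _ _ _
  · rw [Finset.sum_sub_distrib, Finset.sum_sub_distrib]
    congr 1
    exact Equiv.sum_comp τ fun i : Fin r => (Pi.single (⟨n - r + i.1, by omega⟩ : Fin n) 1 : Fin n → ℤ)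

theorem cornerMinor_isHomogeneous {r : ℕ} (hr : 2 * r ≤ n) :
    (cornerMinor n r (by omega)).IsHomogeneous r := by
  refine det_isWeightedHomogeneous (w := fun _ _ => 1) (fun i j => ?_) fun τ => by simp
  simp only [corner, Matrix.submatrix_apply, genericLower, Matrix.of_apply]
  rw [dif_pos (Fin.lt_def.2 (by simp only; omega))]
  exact MvPolynomial.isHomogeneous_X _ _

theorem sign_revPerm (r : ℕ) :
    Equiv.Perm.sign (Fin.revPerm : Equiv.Perm (Fin r)) = (-1) ^ (r * (r - 1) / 2) := by
  rw [Equiv.Perm.sign_eq_prod_prod_Iio]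
  have h : ∀ i : Fin r, ∏ j ∈ Finset.Iio i,
      (if Fin.revPerm j < Fin.revPerm i then (1 : ℤˣ) else -1) = (-1) ^ i.1 := by
    intro i
    rw [Finset.prod_congr rfl fun j hj => if_neg ?_, Finset.prod_const, Fin.card_Iio]
    have := Finset.mem_Iio.1 hj
    rw [Fin.revPerm_apply, Fin.revPerm_apply, Fin.rev_lt_rev]
    exact this.asymm
  rw [Finset.prod_congr rfl fun i _ => h i, Finset.prod_pow_eq_pow_sum,
    Fin.sum_univ_eq_sum_range (fun i => i), Finset.sum_range_id]

theorem lowerMatrix_centerPoint (lam : Fin (n / 2) → ℝ) (i j : Fin n) :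
    lowerMatrix (centerPoint lam) i j =
      if h : i.1 + j.1 + 1 = n ∧ j < i then lam ⟨j.1, by omega⟩ else 0 := by
  simp only [lowerMatrix, Matrix.of_apply]
  by_cases hij : j < i
  · rw [dif_pos hij]
    have hr : ∀ r : Fin (n / 2), (j = cascadeRow r ∧ i = cascadeCol r) ↔
        (j.1 = r.1 ∧ i.1 + j.1 + 1 = n) := fun r => by
      simp only [cascadeCol, cascadeRow, Fin.ext_iff, Fin.val_rev]
      have := r.2
      omega
    simp only [centerPoint, hr]
    split_ifs with h
    · rw [Finset.sum_eq_single ⟨j.1, by omega⟩]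
      · simp [h.1]
      · intro r _ hne
        rw [if_neg fun h' => hne (Fin.ext h'.1.symm)]
      · simp
    · refine Finset.sum_eq_zero fun r _ => if_neg fun h' => h ⟨h'.2, hij⟩
  · rw [dif_neg hij, dif_neg fun h => hij h.2]

theorem det_corner_centerPoint {r : ℕ} (hr : 2 * r ≤ n) (lam : Fin (n / 2) → ℝ) :
    (corner (by omega : r ≤ n) (lowerMatrix (centerPoint lam))).det =
      (-1) ^ (r * (r - 1) / 2) * ∏ j : Fin r, lam ⟨j.1, by omega⟩ := by
  have h : corner (by omega : r ≤ n) (lowerMatrix (centerPoint lam)) =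
      (Matrix.diagonal fun j : Fin r => lam ⟨j.1, by omega⟩).submatrix Fin.revPerm id := by
    ext i j
    rw [corner, Matrix.submatrix_apply, lowerMatrix_centerPoint, Matrix.submatrix_apply,
      Matrix.diagonal_apply]
    have h1 : (Fin.revPerm i = id j) ↔ n - r + i.1 + j.1 + 1 = n := by
      rw [Fin.revPerm_apply, Fin.ext_iff, Fin.val_rev, id]
      omega
    by_cases h2 : n - r + i.1 + j.1 + 1 = n
    · rw [if_pos (h1.2 h2), dif_pos ⟨h2, Fin.lt_def.2 (by simp only; omega)⟩, h1.2 h2]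
      rfl
    · rw [if_neg fun h => h2 (h1.1 h), dif_neg fun h => h2 h.1]
  rw [h, Matrix.det_permute, Matrix.det_diagonal, sign_revPerm]
  push_cast
  rfl

theorem eval_lowerMatrix {R : Type*} [Zero R] (ξ : PosRoot n → R) (p : PosRoot n) :
    lowerMatrix ξ p.1.2 p.1.1 = ξ p := dif_pos p.2

/-- The coadjoint action `ξ ↦ π_{𝔫₋}(c⁻¹ ξ c)` in coordinates. -/
def coAd (c : borel n) (ξ : PosRoot n → ℝ) (p : PosRoot n) : ℝ := ∑ q, adCoeff c p q * ξ q

theorem coAd_eq (c : borel n) (X : Matrix (Fin n) (Fin n) ℝ) (hX : ∀ i j, i ≤ j → X i j = 0)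
    (p : PosRoot n) :
    coAd c (fun p => X p.1.2 p.1.1) p = ((c⁻¹).1.1 * X * c.1.1) p.1.2 p.1.1 := by
  rw [coAd, Matrix.mul_apply]
  simp only [adCoeff]
  rw [sum_posRoot (fun k l => entry c k p.1.1 * entry c⁻¹ p.1.2 l * X l k)]
  refine Finset.sum_congr rfl fun k _ => ?_
  rw [Matrix.mul_apply, Finset.sum_mul]
  refine Finset.sum_congr rfl fun l _ => ?_
  change _ = entry c⁻¹ p.1.2 l * X l k * entry c k p.1.1
  split_ifs with h
  · ring
  · rw [hX l k (not_lt.1 h)]; ring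

theorem eval_cornerMinor_coAd {r : ℕ} (hr : 2 * r ≤ n) (c : borel n) (ξ : PosRoot n → ℝ) :
    MvPolynomial.eval (coAd c ξ) (cornerMinor n r (by omega)) =
      (∏ j : Fin r, (entry c ⟨j.1, by omega⟩ ⟨j.1, by omega⟩ /
        entry c (Fin.rev ⟨j.1, by omega⟩) (Fin.rev ⟨j.1, by omega⟩))) *
          MvPolynomial.eval ξ (cornerMinor n r (by omega)) := by
  have hX : ∀ i j, i ≤ j → lowerMatrix ξ i j = 0 := fun i j h => dif_neg h.not_gt
  have e : ξ = fun p => lowerMatrix ξ p.1.2 p.1.1 := funext fun p => (eval_lowerMatrix ξ p).symm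
  have h1 : coAd c ξ = fun p => ((c⁻¹).1.1 * lowerMatrix ξ * c.1.1) p.1.2 p.1.1 := by
    conv_lhs => rw [e]
    exact funext (coAd_eq c _ hX)
  have hinv : ∀ i, entry c⁻¹ i i = (entry c i i)⁻¹ := fun i => by
    refine eq_inv_of_mul_eq_one_left ?_
    rw [← entry_mul_diag, inv_mul_cancel, entry_one, if_pos rfl]
  rw [h1, eval_cornerMinor hr,
    det_corner_mul_mul _ (A := (c⁻¹).1.1) (C := c.1.1) (c⁻¹).2.1 c.2.1,
    ← eval_cornerMinor hr (lowerMatrix ξ), ← e, mul_right_comm]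
  congr 1
  rw [Finset.prod_div_distrib, div_eq_inv_mul, ← Finset.prod_inv_distrib]
  congr 1
  rw [← Equiv.prod_comp Fin.revPerm]
  refine Finset.prod_congr rfl fun j _ => ?_
  refine (hinv _).trans ?_
  have : (⟨n - r + (Fin.revPerm j).1, by omega⟩ : Fin n) = Fin.rev ⟨j.1, by omega⟩ := by
    apply Fin.ext
    simp only [Fin.revPerm_apply, Fin.val_rev]
    omega
  rw [this]

/-! ### The coadjoint orbit of the base point is Zariski dense -/

section Density

open scoped Topology

attribute [local instance] Matrix.linftyOpNormedRing Matrix.linftyOpNormedAlgebra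

/-- The point of `𝔰^*` all of whose coordinates are `1`. -/
def basePoint (n : ℕ) : PosRoot n → ℝ := centerPoint fun _ => 1

/-- The upper triangular part of an array, as a matrix. -/
def upperPart (n : ℕ) : (Fin n → Fin n → ℝ) →ₗ[ℝ] Matrix (Fin n) (Fin n) ℝ where
  toFun u := Matrix.of fun i j => if i ≤ j then u i j else 0
  map_add' u v := by ext i j; simp only [Matrix.of_apply, Matrix.add_apply]; split_ifs <;> simp
  map_smul' c u := by ext i j; simp only [Matrix.of_apply, Matrix.smul_apply]; split_ifs <;> simp

/-- The coordinates of the strictly lower triangular part of a matrix. -/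
def lowerCoords (n : ℕ) : Matrix (Fin n) (Fin n) ℝ →ₗ[ℝ] (PosRoot n → ℝ) where
  toFun X p := X p.1.2 p.1.1
  map_add' _ _ := rfl
  map_smul' _ _ := rfl

theorem lowerMatrix_basePoint (i j : Fin n) :
    lowerMatrix (basePoint n) i j = if i = Fin.rev j ∧ j < i then 1 else 0 := by
  rw [basePoint, lowerMatrix_centerPoint]
  have : (i.1 + j.1 + 1 = n ∧ j < i) ↔ (i = Fin.rev j ∧ j < i) := by
    rw [Fin.ext_iff, Fin.val_rev]; omega
  simp only [this]
  split_ifs <;> rfl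

theorem exists_upperPart_commutator (Z : PosRoot n → ℝ) :
    ∃ u, lowerCoords n (upperPart n u * lowerMatrix (basePoint n) -
      lowerMatrix (basePoint n) * upperPart n u) = Z := by
  let z : Fin n → Fin n → ℝ := fun j i => if h : j < i then Z ⟨(j, i), h⟩ else 0
  refine ⟨fun i k => if i = k then (if Fin.rev i < i then z (Fin.rev i) i else 0) else
    if Fin.rev k < i ∧ i < k then z (Fin.rev k) i else
    if i < k ∧ k < Fin.rev i then - z k (Fin.rev i) else 0, ?_⟩
  funext ⟨⟨j, i⟩, hji⟩
  set u : Fin n → Fin n → ℝ := fun i k =>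
    if i = k then (if Fin.rev i < i then z (Fin.rev i) i else 0) else
    if Fin.rev k < i ∧ i < k then z (Fin.rev k) i else
    if i < k ∧ k < Fin.rev i then - z k (Fin.rev i) else 0 with hu
  have h1 : (upperPart n u * lowerMatrix (basePoint n)) i j =
      if j < Fin.rev j then upperPart n u i (Fin.rev j) else 0 := by
    rw [Matrix.mul_apply, Finset.sum_eq_single (Fin.rev j)]
    · rw [lowerMatrix_basePoint]; simp
    · intro k _ hk
      rw [lowerMatrix_basePoint, if_neg fun h => hk h.1, mul_zero]
    · simp
  have h2 : (lowerMatrix (basePoint n) * upperPart n u) i j =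
      if Fin.rev i < i then upperPart n u (Fin.rev i) j else 0 := by
    rw [Matrix.mul_apply, Finset.sum_eq_single (Fin.rev i)]
    · rw [lowerMatrix_basePoint]; simp
    · intro k _ hk
      rw [lowerMatrix_basePoint, if_neg fun h => hk (by rw [h.1, Fin.rev_rev]), zero_mul]
    · simp
  have hz : z j i = Z ⟨(j, i), hji⟩ := dif_pos hji
  change (upperPart n u * lowerMatrix (basePoint n)) i j -
    (lowerMatrix (basePoint n) * upperPart n u) i j = _
  rw [h1, h2, ← hz]
  simp only [upperPart, LinearMap.coe_mk, AddHom.coe_mk, Matrix.of_apply, hu, Fin.rev_rev]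
  have hji' : j < i := hji
  clear_value z
  clear h1 h2 hz hji hu u
  have hr : ∀ k : Fin n, (Fin.rev k).1 = n - 1 - k.1 := fun k => by rw [Fin.val_rev]; omega
  have hi := i.2
  have hj := j.2
  rcases lt_trichotomy i (Fin.rev j) with h | h | h
  · have a1 : j < Fin.rev j := hji'.trans h
    have a2 : ¬ (Fin.rev i ≤ j) := by rw [Fin.le_def, hr]; rw [Fin.lt_def, hr] at h; omega
    simp [a1, h.le, h.ne, h, hji', a2]
  · have a1 : j < Fin.rev j := h ▸ hji'
    have a2 : Fin.rev i = j := by rw [h, Fin.rev_rev]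
    subst a2
    simp only [Fin.rev_rev] at a1 ⊢
    simp [a1, a1.asymm]
  · have a2 : ¬ (i ≤ Fin.rev j) := not_le.2 h
    have a3 : Fin.rev i < j := by rw [Fin.lt_def, hr] at h ⊢; omega
    have a4 : Fin.rev i < i := a3.trans hji'
    have a5 : ¬ Fin.rev j < Fin.rev i := by rw [Fin.rev_lt_rev]; exact hji'.asymm
    simp [a2, a3, a3.le, a4, a3.ne, a5, hji']

theorem exists_coAd_basePoint (u : Fin n → Fin n → ℝ)
    (hu : ∀ i, 0 < (1 + upperPart n u) i i) :
    ∃ c : borel n, coAd c (basePoint n) = lowerCoords n ((1 + upperPart n u) *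
      lowerMatrix (basePoint n) * Ring.inverse (1 + upperPart n u)) := by
  have htri : (1 + upperPart n u).IsUpperTriangular := fun i j (h : j < i) => by
    simp [upperPart, h.not_ge, Matrix.one_apply_ne h.ne']
  have hdet : (1 + upperPart n u).det ≠ 0 := by
    rw [Matrix.det_of_isUpperTriangular htri]
    exact Finset.prod_ne_zero_iff.2 fun i _ => (hu i).ne'
  let a : borel n := ⟨Matrix.GeneralLinearGroup.mkOfDetNeZero _ hdet, fun i j h => htri h, hu⟩
  refine ⟨a⁻¹, ?_⟩
  have hinv : Ring.inverse (1 + upperPart n u) = (a⁻¹).1.1 := Ring.inverse_unit a.1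
  rw [hinv]
  have hX : ∀ i j, i ≤ j → lowerMatrix (basePoint n) i j = 0 := fun i j h => dif_neg h.not_gt
  funext p
  have h := coAd_eq a⁻¹ _ hX p
  rw [funext (eval_lowerMatrix (basePoint n)), inv_inv] at h
  exact h

theorem exists_hasStrictFDerivAt_conj {E F A : Type*} [NormedAddCommGroup E] [NormedSpace ℝ E]
    [NormedAddCommGroup F] [NormedSpace ℝ F] [NormedRing A] [NormedAlgebra ℝ A] [CompleteSpace A]
    (U : E →L[ℝ] A) (L : A →L[ℝ] F) (X₀ : A) :
    ∃ Φ' : E →L[ℝ] F,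
      HasStrictFDerivAt (fun u => L ((1 + U u) * X₀ * Ring.inverse (1 + U u))) Φ' 0 ∧
        ∀ u, Φ' u = L (U u * X₀ - X₀ * U u) := by
  have h1 : HasStrictFDerivAt (fun u => 1 + U u) U 0 := U.hasStrictFDerivAt.const_add 1
  have h2 : HasStrictFDerivAt (fun u => Ring.inverse (1 + U u)) (-U) 0 := by
    have h : HasStrictFDerivAt Ring.inverse (-ContinuousLinearMap.mulLeftRight ℝ A 1 1)
        (1 + U 0) := by
      simpa using hasStrictFDerivAt_ringInverse (𝕜 := ℝ) (1 : Aˣ)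
    refine (h.comp (0 : E) h1).congr_fderiv ?_
    ext u : 1
    simp
  refine ⟨_, L.hasStrictFDerivAt.comp (0 : E)
    ((h1.mul' (hasStrictFDerivAt_const X₀ 0)).mul' h2), fun u => ?_⟩
  simp [sub_eq_neg_add]

theorem coAd_basePoint_mem_nhds :
    Set.range (fun c : borel n => coAd c (basePoint n)) ∈ 𝓝 (basePoint n) := by
  set X₀ := lowerMatrix (basePoint n) with hX₀
  let U := LinearMap.toContinuousLinearMap (upperPart n)
  let Lc := LinearMap.toContinuousLinearMap (lowerCoords n)
  let Φ : (Fin n → Fin n → ℝ) → (PosRoot n → ℝ) := fun u =>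
    Lc ((1 + U u) * X₀ * Ring.inverse (1 + U u))
  obtain ⟨Φ', hΦ, hΦ'⟩ := exists_hasStrictFDerivAt_conj U Lc X₀
  have hsurj : Φ'.range = ⊤ := LinearMap.range_eq_top.2 fun Z => by
    obtain ⟨u, hu⟩ := exists_upperPart_commutator Z
    exact ⟨u, (hΦ' u).trans hu⟩
  have hΦ0 : Φ 0 = basePoint n := by
    funext p
    change ((1 + upperPart n 0) * X₀ * Ring.inverse (1 + upperPart n 0)) p.1.2 p.1.1 = _
    rw [map_zero, add_zero, one_mul, Ring.inverse_one, mul_one, hX₀, eval_lowerMatrix]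
  have hpos : ∀ᶠ u in 𝓝 (0 : Fin n → Fin n → ℝ), ∀ i, 0 < (1 + upperPart n u) i i := by
    refine Filter.eventually_all.2 fun i => ?_
    have hc : Continuous fun u : Fin n → Fin n → ℝ => (1 + upperPart n u) i i := by
      have : (fun u : Fin n → Fin n → ℝ => (1 + upperPart n u) i i) = fun u => 1 + u i i := by
        funext u
        simp [upperPart]
      rw [this]
      fun_prop
    exact hc.continuousAt.eventually (lt_mem_nhds (by simp))
  have hmap : Filter.map Φ (𝓝 0) = 𝓝 (basePoint n) := by
    rw [← hΦ0]
    exact hΦ.map_nhds_eq_of_surj hsurj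
  rw [← hmap]
  refine Filter.mem_map.2 (hpos.mono fun u hu => ?_)
  obtain ⟨c, hc⟩ := exists_coAd_basePoint u hu
  exact ⟨c, hc⟩

theorem eq_zero_of_forall_eval_coAd_basePoint {P : MvPolynomial (PosRoot n) ℂ}
    (hP : ∀ c : borel n, MvPolynomial.eval (fun p => (coAd c (basePoint n) p : ℂ)) P = 0) :
    P = 0 := by
  obtain ⟨ε, hε, hball⟩ := Metric.mem_nhds_iff.1 (coAd_basePoint_mem_nhds (n := n))
  refine MvPolynomial.funext_set
    (fun p => Complex.ofReal '' Metric.ball (basePoint n p) ε) (fun p => ?_) fun x hx => ?_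
  · exact ((infinite_of_mem_nhds _ (Metric.ball_mem_nhds _ hε))).image
      Complex.ofReal_injective.injOn
  · choose y hy using fun p => hx p (Set.mem_univ p)
    have hy' : y ∈ Metric.ball (basePoint n) ε := by
      rw [ball_pi _ hε]
      exact fun p _ => (hy p).1
    obtain ⟨c, hc⟩ := hball hy'
    have hxc : x = fun p => (coAd c (basePoint n) p : ℂ) := by
      funext p
      rw [← (hy p).2]
      exact congrArg (fun f => ((f p : ℝ) : ℂ)) hc.symm
    rw [hxc, hP, map_zero]

end Density

/-! ### The symbol -/

/-- The exponent of the `r`-th corner minor in the symbol. -/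
def minorExponent (r : Fin (n / 2)) : ℕ := if n = 2 * (r.1 + 1) then 1 else 2

theorem sum_minorExponent (k : Fin (n / 2)) :
    ∑ r, (if k ≤ r then minorExponent r else 0) = stratumDim k + 1 := by
  have h : ∀ N, 2 * N ≤ n → ∑ s ∈ Finset.range N,
      (if k.1 ≤ s then (if n = 2 * (s + 1) then 1 else 2) else 0) =
        if N ≤ k.1 then 0 else (n - 2 * k.1 - 1) - (n - 2 * N - 1) := by
    intro N
    induction N with
    | zero => simp
    | succ N ih =>
      intro hN
      rw [Finset.sum_range_succ, ih (by omega)]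
      split_ifs <;> omega
  have hk := k.2
  have h1 := h (n / 2) (by omega)
  rw [if_neg (by omega), Finset.sum_range] at h1
  simp only [stratumDim]
  refine (h1.trans ?_)
  omega

@[to_additive]
theorem prod_fin_succ_eq {M : Type*} [CommMonoid M] (x : Fin (n / 2) → M) (r : Fin (n / 2)) :
    ∏ j : Fin (r.1 + 1), x ⟨j.1, by omega⟩ = ∏ k, if k ≤ r then x k else 1 := by
  rw [← Finset.prod_filter]
  refine Finset.prod_bij (fun j _ => ⟨j.1, by omega⟩) (fun j _ => ?_) (fun i _ j _ h => ?_)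
    (fun k hk => ?_) fun _ _ => rfl
  · exact Finset.mem_filter.2 ⟨Finset.mem_univ _, Fin.le_def.2 (Nat.lt_succ_iff.1 j.2)⟩
  · exact Fin.ext (Fin.mk.inj h)
  · exact ⟨⟨k.1, Nat.lt_succ_iff.2 (Fin.le_def.1 (Finset.mem_filter.1 hk).2)⟩,
      Finset.mem_univ _, rfl⟩

@[to_additive]
theorem prod_prod_pow_minorExponent {M : Type*} [CommMonoid M] (x : Fin (n / 2) → M) :
    ∏ r : Fin (n / 2), (∏ j : Fin (r.1 + 1), x ⟨j.1, by omega⟩) ^ minorExponent r =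
      ∏ k, x k ^ (stratumDim k + 1) := by
  simp only [prod_fin_succ_eq, ← Finset.prod_pow]
  rw [Finset.prod_comm]
  refine Finset.prod_congr rfl fun k _ => ?_
  rw [← sum_minorExponent, ← Finset.prod_pow_eq_pow_sum]
  refine Finset.prod_congr rfl fun r _ => ?_
  split_ifs <;> simp

/-- The sign of the symbol. -/
def symbolSign (n : ℕ) : ℝ := if Even n then (-1) ^ (n / 2 * (n / 2 - 1) / 2) else 1

theorem symbolSign_mul_prod :
    symbolSign n * ∏ r : Fin (n / 2), ((-1) ^ ((r.1 + 1) * (r.1 + 1 - 1) / 2) : ℝ) ^ minorExponent r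
      = 1 := by
  have h2 : ∀ r : Fin (n / 2), n ≠ 2 * (r.1 + 1) →
      ((-1) ^ ((r.1 + 1) * (r.1 + 1 - 1) / 2) : ℝ) ^ minorExponent r = 1 := fun r hr => by
    rw [minorExponent, if_neg hr, ← pow_mul, mul_comm, pow_mul, neg_one_sq, one_pow]
  by_cases hn : Even n
  · rw [symbolSign, if_pos hn]
    rcases Nat.eq_zero_or_pos (n / 2) with h0 | h0
    · have : IsEmpty (Fin (n / 2)) := by rw [h0]; infer_instance
      simp [h0]
    · have hn' : n = 2 * (n / 2) := by
        obtain ⟨k, hk⟩ := hn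
        omega
      rw [Finset.prod_eq_single (⟨n / 2 - 1, by omega⟩ : Fin (n / 2))]
      · have e : n / 2 - 1 + 1 = n / 2 := by omega
        simp only [minorExponent, e]
        rw [if_pos hn', pow_one, ← mul_pow]
        simp
      · intro r _ hr
        refine h2 r fun h => hr (Fin.ext ?_)
        simp only
        omega
      · simp
  · rw [symbolSign, if_neg hn, one_mul]
    refine Finset.prod_eq_one fun r _ => h2 r fun h => hn ?_
    exact ⟨r.1 + 1, by omega⟩

/-- The symbol as a polynomial in the chop invariants. -/
def symbolInMinors (n : ℕ) : MvPolynomial (Fin (n / 2)) ℝ :=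
  MvPolynomial.C (symbolSign n) * ∏ r, MvPolynomial.X r ^ minorExponent r

/-- The symbol of Wolf's operator. -/
def wolfSymbol (n : ℕ) : SymAlg n :=
  MvPolynomial.C (symbolSign n) * ∏ r : Fin (n / 2), chopInvariant n (r.1 + 1) ^ minorExponent r

theorem aeval_symbolInMinors :
    MvPolynomial.aeval (fun r : Fin (n / 2) => chopInvariant n (r.1 + 1)) (symbolInMinors n) =
      wolfSymbol n := by
  simp [symbolInMinors, wolfSymbol]

theorem exists_chopInvariant_eq {r : ℕ} (hr : 2 * r ≤ n) :
    ∃ ε : ℤˣ, (n = 2 * r → ε = 1) ∧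
      chopInvariant n r = (ε : ℤ) • cornerMinor n r (by omega) :=
  coeff_det_chop r hr (genericLower n)

theorem chopInvariant_pow (r : Fin (n / 2)) :
    chopInvariant n (r.1 + 1) ^ minorExponent r =
      cornerMinor n (r.1 + 1) (by omega) ^ minorExponent r := by
  obtain ⟨ε, hε, h⟩ := exists_chopInvariant_eq (show 2 * (r.1 + 1) ≤ n by omega)
  rw [h, minorExponent]
  split_ifs with h'
  · rw [hε h']; simp
  · rcases Int.units_eq_one_or ε with rfl | rfl <;> simp

theorem wolfSymbol_eq : wolfSymbol n = MvPolynomial.C (symbolSign n) *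
    ∏ r : Fin (n / 2), cornerMinor n (r.1 + 1) (by omega) ^ minorExponent r := by
  simp only [wolfSymbol, chopInvariant_pow]

theorem prod_Icc_eq {M : Type*} [CommMonoid M] (f : ℕ → M) (N : ℕ) :
    ∏ r ∈ Finset.Icc 1 N, f r = ∏ s ∈ Finset.range N, f (s + 1) := by
  rw [Finset.range_eq_Ico, Finset.prod_Ico_add' f 0 N 1]
  rfl

theorem wolfSymbol_of_odd (hn : Odd n) :
    wolfSymbol n = ∏ r ∈ Finset.Icc 1 (n / 2), chopInvariant n r ^ 2 := by
  rw [wolfSymbol, symbolSign, if_neg (Nat.not_even_iff_odd.2 hn), map_one, one_mul, prod_Icc_eq,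
    Finset.prod_range]
  refine Finset.prod_congr rfl fun r _ => ?_
  rw [minorExponent, if_neg]
  intro h
  exact Nat.not_even_iff_odd.2 hn ⟨r.1 + 1, by omega⟩

theorem wolfSymbol_of_even (hn : Even n) :
    wolfSymbol n = (-1) ^ (n / 2 * (n / 2 - 1) / 2) * (chopInvariant n (n / 2) *
      ∏ r ∈ Finset.Icc 1 (n / 2 - 1), chopInvariant n r ^ 2) := by
  have hn' : n = 2 * (n / 2) := by
    obtain ⟨k, hk⟩ := hn
    omega
  rw [wolfSymbol, symbolSign, if_pos hn, map_pow, map_neg, map_one, prod_Icc_eq]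
  congr 1
  have h1 : ∏ r : Fin (n / 2), chopInvariant n (r.1 + 1) ^ minorExponent r =
      ∏ s ∈ Finset.range (n / 2), chopInvariant n (s + 1) ^ (if n = 2 * (s + 1) then 1 else 2) :=
    (Finset.prod_range fun s => chopInvariant n (s + 1) ^ (if n = 2 * (s + 1) then 1 else 2)).symm
  rw [h1]
  rcases Nat.eq_zero_or_pos (n / 2) with h0 | h0
  · have hz : chopInvariant n (n / 2) = 1 := by
      obtain ⟨ε, hε, h⟩ := exists_chopInvariant_eq (show 2 * (n / 2) ≤ n by omega)
      have hE : IsEmpty (Fin (n / 2)) := by rw [h0]; infer_instance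
      rw [h, hε hn', cornerMinor, Matrix.det_isEmpty]
      simp
    rw [hz]
    simp [h0]
  · obtain ⟨k, hk⟩ : ∃ k, n / 2 = k + 1 := ⟨n / 2 - 1, by omega⟩
    rw [hk, Finset.prod_range_succ, mul_comm, Nat.add_sub_cancel, if_pos (by omega), pow_one]
    congr 1
    refine Finset.prod_congr rfl fun s hs => ?_
    have := Finset.mem_range.1 hs
    rw [if_neg (by omega)]

/-- The degree of the symbol. -/
def symbolDegree (n : ℕ) : ℕ := ∑ r : Fin (n / 2), (stratumDim r + 1)

theorem two_mul_symbolDegree : 2 * symbolDegree n = n * (n - 1) / 2 + n / 2 := by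
  have h : ∀ N, 2 * N ≤ n → ∑ s ∈ Finset.range N, (n - 2 * (s + 1) + 1) = N * (n - N) := by
    intro N
    induction N with
    | zero => simp
    | succ N ih =>
      intro hN
      obtain ⟨m, rfl⟩ := Nat.exists_eq_add_of_le hN
      rw [Finset.sum_range_succ, ih (by omega)]
      rw [show 2 * (N + 1) + m - 2 * (N + 1) = m by omega,
        show 2 * (N + 1) + m - N = N + 2 + m by omega,
        show 2 * (N + 1) + m - (N + 1) = N + 1 + m by omega]
      ring
  have h1 : symbolDegree n = n / 2 * (n - n / 2) := by
    rw [← h _ (by omega), Finset.sum_range]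
    rfl
  rw [h1]
  rcases Nat.even_or_odd' n with ⟨k, rfl | rfl⟩
  · rw [show 2 * k / 2 = k by omega, show 2 * k - k = k by omega, mul_assoc,
      Nat.mul_div_cancel_left _ two_pos]
    rcases k with _ | k
    · rfl
    · rw [show 2 * (k + 1) - 1 = 2 * k + 1 by omega]; ring
  · rw [show (2 * k + 1) / 2 = k by omega, show 2 * k + 1 - k = k + 1 by omega,
      Nat.add_sub_cancel, show (2 * k + 1) * (2 * k) = 2 * ((2 * k + 1) * k) by ring,
      Nat.mul_div_cancel_left _ two_pos]
    ring

theorem symbolDegree_of_odd (hn : Odd n) : symbolDegree n = n / 2 * (n / 2 + 1) := by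
  have h := two_mul_symbolDegree (n := n)
  obtain ⟨k, rfl⟩ := hn
  rw [Nat.add_sub_cancel, show (2 * k + 1) * (2 * k) = 2 * ((2 * k + 1) * k) by ring,
      Nat.mul_div_cancel_left _ two_pos, show (2 * k + 1) / 2 = k by omega] at h
  rw [show (2 * k + 1) / 2 = k by omega]
  linarith

theorem symbolDegree_of_even (hn : Even n) : symbolDegree n = (n / 2) ^ 2 := by
  have h := two_mul_symbolDegree (n := n)
  obtain ⟨k, rfl⟩ := hn
  rw [← two_mul] at h ⊢
  rw [mul_assoc, Nat.mul_div_cancel_left _ two_pos, show 2 * k / 2 = k by omega] at h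
  rw [show 2 * k / 2 = k by omega]
  rcases k with _ | k
  · simpa using h
  · rw [show 2 * (k + 1) - 1 = 2 * k + 1 by omega] at h
    linarith

theorem wolfSymbol_isHomogeneous : (wolfSymbol n).IsHomogeneous (symbolDegree n) := by
  rw [wolfSymbol_eq, ← zero_add (symbolDegree n)]
  refine (MvPolynomial.isHomogeneous_C _ _).mul ?_
  have h : symbolDegree n = ∑ r : Fin (n / 2), (r.1 + 1) * minorExponent r := by
    have := sum_sum_nsmul_minorExponent (n := n) fun _ => (1 : ℕ)
    simp only [smul_eq_mul, Finset.sum_const, Finset.card_univ, Fintype.card_fin, mul_one] at this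
    rw [symbolDegree, ← this]
    exact Finset.sum_congr rfl fun r _ => mul_comm _ _
  rw [h]
  exact MvPolynomial.IsHomogeneous.prod _ _ _ fun r _ =>
    (cornerMinor_isHomogeneous (by omega)).pow _

/-- The weight of the symbol under the diagonal torus. -/
def symbolWeight (n : ℕ) : Fin n → ℤ :=
  ∑ r : Fin (n / 2), (stratumDim r + 1) •
    (Pi.single (cascadeRow r) 1 - Pi.single (cascadeCol r) 1)

theorem wolfSymbol_isWeightedHomogeneous :
    (wolfSymbol n).IsWeightedHomogeneous rootWeight (symbolWeight n) := by
  rw [wolfSymbol_eq, ← zero_add (symbolWeight n)]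
  refine (MvPolynomial.isWeightedHomogeneous_C _ _).mul ?_
  rw [symbolWeight, ← sum_sum_nsmul_minorExponent]
  refine MvPolynomial.IsWeightedHomogeneous.prod _ _ _ fun r _ => ?_
  refine MvPolynomial.IsWeightedHomogeneous.pow ?_ _
  have h := cornerMinor_isWeightedHomogeneous (n := n) (r := r.1 + 1) (by omega)
  have e : ∑ j : Fin (r.1 + 1), (Pi.single (⟨j.1, by omega⟩ : Fin n) 1 -
        Pi.single (⟨n - (r.1 + 1) + j.1, by omega⟩ : Fin n) 1 : Fin n → ℤ) =
      ∑ j : Fin (r.1 + 1), (Pi.single (cascadeRow ⟨j.1, by omega⟩) 1 -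
        Pi.single (cascadeCol ⟨j.1, by omega⟩) 1) := by
    rw [Finset.sum_sub_distrib, Finset.sum_sub_distrib]
    congr 1
    rw [← Equiv.sum_comp Fin.revPerm]
    refine Finset.sum_congr rfl fun j _ => ?_
    congr 1
    apply Fin.ext
    simp only [Fin.revPerm_apply, Fin.val_rev, cascadeCol, cascadeRow]
    omega
  rwa [e] at h

theorem eval_wolfSymbol_centerPoint (lam : Fin (n / 2) → ℝ) :
    MvPolynomial.eval (centerPoint lam) (wolfSymbol n) = pfaffian lam * detCenters lam := by
  have h : ∀ r : Fin (n / 2), MvPolynomial.eval (centerPoint lam)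
      (cornerMinor n (r.1 + 1) (by omega)) =
        (-1) ^ ((r.1 + 1) * (r.1 + 1 - 1) / 2) * ∏ j : Fin (r.1 + 1), lam ⟨j.1, by omega⟩ := by
    intro r
    rw [← det_corner_centerPoint (by omega), ← eval_cornerMinor (by omega)]
    congr 1
    rw [funext (eval_lowerMatrix (centerPoint lam))]
  rw [wolfSymbol_eq, map_mul, MvPolynomial.eval_C, map_prod]
  simp only [map_pow, h, mul_pow]
  rw [Finset.prod_mul_distrib, ← mul_assoc, symbolSign_mul_prod, one_mul,
    prod_prod_pow_minorExponent lam, pfaffian, detCenters, ← Finset.prod_mul_distrib]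
  simp only [pow_succ]

theorem eval_wolfSymbol_coAd (c : borel n) (ξ : PosRoot n → ℝ) :
    MvPolynomial.eval (coAd c ξ) (wolfSymbol n) =
      modularWeight c * MvPolynomial.eval ξ (wolfSymbol n) := by
  have h := prod_prod_pow_minorExponent (M := ℝ) fun r : Fin (n / 2) =>
    entry c (cascadeRow r) (cascadeRow r) / entry c (cascadeCol r) (cascadeCol r)
  rw [wolfSymbol_eq, map_mul, map_mul, MvPolynomial.eval_C, MvPolynomial.eval_C, map_prod, map_prod, modularWeight, ← h,
    mul_left_comm, ← Finset.prod_mul_distrib]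
  congr 1
  refine Finset.prod_congr rfl fun r _ => ?_
  rw [map_pow, map_pow, ← mul_pow, eval_cornerMinor_coAd (by omega)]
  rfl

theorem isCoadjointInvariant_wolfSymbol : IsCoadjointInvariant (wolfSymbol n) := by
  intro g hg X hX
  have h := eval_wolfSymbol_coAd g fun p => X p.1.2 p.1.1
  have h1 : modularWeight g = 1 := by
    simp [modularWeight, hg]
  rw [h1, one_mul, funext (coAd_eq g X hX)] at h
  exact h

theorem aeval_chopInvariant_injective :
    Function.Injective (MvPolynomial.aeval (R := ℝ)
      (fun r : Fin (n / 2) => chopInvariant n (r.1 + 1))) := by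
  intro Q Q' hQ
  have hε : ∀ r : Fin (n / 2), ∃ ε : ℝ, ε ≠ 0 ∧ ∀ lam : Fin (n / 2) → ℝ,
      MvPolynomial.eval (centerPoint lam) (chopInvariant n (r.1 + 1)) =
        ε * ∏ j : Fin (r.1 + 1), lam ⟨j.1, by omega⟩ := by
    intro r
    obtain ⟨ε, -, h⟩ := exists_chopInvariant_eq (show 2 * (r.1 + 1) ≤ n by omega)
    refine ⟨((ε : ℤ) : ℝ) * (-1) ^ ((r.1 + 1) * (r.1 + 1 - 1) / 2), ?_, fun lam => ?_⟩
    · refine mul_ne_zero ?_ (pow_ne_zero _ (by norm_num))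
      exact_mod_cast ε.ne_zero
    · rw [h, map_zsmul, zsmul_eq_mul, mul_assoc, ← det_corner_centerPoint (by omega),
        ← eval_cornerMinor (by omega), funext (eval_lowerMatrix (centerPoint lam))]
  choose ε hε0 hε using hε
  refine MvPolynomial.funext_set (fun _ => {0}ᶜ) (fun _ => (Set.finite_singleton 0).infinite_compl)
    fun y hy => ?_
  have hy0 : ∀ r, y r ≠ 0 := fun r => hy r (Set.mem_univ r)
  let Z : ℕ → ℝ := fun s => if h : s - 1 < n / 2 ∧ s ≠ 0 then y ⟨s - 1, h.1⟩ / ε ⟨s - 1, h.1⟩ else 1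
  have hZ : ∀ s, Z s ≠ 0 := fun s => by
    simp only [Z]
    split_ifs
    · exact div_ne_zero (hy0 _) (hε0 _)
    · exact one_ne_zero
  have hprod : ∀ N, ∏ s ∈ Finset.range N, Z (s + 1) / Z s = Z N := by
    intro N
    induction N with
    | zero => simp [Z]
    | succ N ih => rw [Finset.prod_range_succ, ih, mul_div_cancel₀ _ (hZ N)]
  have hlam : (fun r : Fin (n / 2) => MvPolynomial.eval
      (centerPoint fun r : Fin (n / 2) => Z (r.1 + 1) / Z r.1) (chopInvariant n (r.1 + 1))) = y := by
    funext r
    rw [hε, ← Finset.prod_range fun s => Z (s + 1) / Z s, hprod]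
    simp only [Z]
    rw [dif_pos ⟨r.2, Nat.succ_ne_zero _⟩]
    exact mul_div_cancel₀ _ (hε0 r)
  have h := congrArg (MvPolynomial.eval (centerPoint fun r : Fin (n / 2) => Z (r.1 + 1) / Z r.1)) hQ
  have he : ∀ (ξ : PosRoot n → ℝ) (Q : MvPolynomial (Fin (n / 2)) ℝ), MvPolynomial.eval ξ
      (MvPolynomial.aeval (fun r : Fin (n / 2) => chopInvariant n (r.1 + 1)) Q) =
        MvPolynomial.eval (fun r => MvPolynomial.eval ξ (chopInvariant n (r.1 + 1))) Q := by
    intro ξ Q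
    induction Q using MvPolynomial.induction_on with
    | C a => simp
    | add p q hp hq => rw [map_add, map_add, map_add, hp, hq]
    | mul_X p i hp => rw [map_mul, map_mul, map_mul, hp]; simp
  rwa [he, he, hlam] at h

theorem card_posRoot : Fintype.card (PosRoot n) = n * (n - 1) / 2 := by
  rw [Fintype.card_eq_sum_ones, sum_posRoot fun _ _ => 1, Finset.sum_comm, ← Finset.sum_range_id,
    Finset.sum_range]
  refine Finset.sum_congr rfl fun j _ => ?_
  rw [← Finset.sum_filter, ← Finset.card_eq_sum_ones, ← Fin.card_Iio j]
  congr 1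
  ext i
  simp

theorem finrank_nilradical : Module.finrank ℝ (nilradical n) = n * (n - 1) / 2 := by
  let e : nilradical n ≃ₗ[ℝ] (PosRoot n → ℝ) :=
    { toFun := fun X p => X.1 p.1.1 p.1.2
      map_add' := fun _ _ => rfl
      map_smul' := fun _ _ => rfl
      invFun := fun ξ => ⟨(lowerMatrix ξ).transpose, fun i j h => dif_neg h.not_gt⟩
      left_inv := fun X => by
        ext i j
        by_cases h : i < j
        · exact dif_pos h
        · exact (dif_neg h).trans (X.2 i j (not_lt.1 h)).symm
      right_inv := fun ξ => funext fun p => dif_pos p.2 }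
  rw [e.finrank_eq, Module.finrank_pi, card_posRoot]

theorem finrank_centers : Module.finrank ℝ (centers n) = n / 2 := by
  have h : LinearIndependent ℝ fun r : Fin (n / 2) =>
      Matrix.single (cascadeRow r) (cascadeCol r) (1 : ℝ) := by
    have h0 := (Matrix.stdBasis ℝ (Fin n) (Fin n)).linearIndependent.comp
      (fun r : Fin (n / 2) => (cascadeRow r, cascadeCol r)) fun r s hrs => by
        have := congrArg (fun x => (Prod.fst x).1) hrs
        exact Fin.ext this
    simpa [Function.comp_def, Matrix.stdBasis_eq_single] using h0
  rw [centers, finrank_span_eq_card h, Fintype.card_fin]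

/-! ### The operator -/

/-- The operators `-i X̃` attached to the basis of `𝔫`. -/
def symbolField (p : PosRoot n) : Op n := (-Complex.I) • vectorField p

/-- A real polynomial, with complex coefficients. -/
def complexify {σ : Type*} : MvPolynomial σ ℝ →+* MvPolynomial σ ℂ :=
  MvPolynomial.map (algebraMap ℝ ℂ)

theorem complexify_injective {σ : Type*} : Function.Injective (complexify (σ := σ)) :=
  MvPolynomial.map_injective _ Complex.ofReal_injective

theorem eval_complexify {σ : Type*} (ξ : σ → ℝ) (P : MvPolynomial σ ℝ) :
    MvPolynomial.eval (fun p => (ξ p : ℂ)) (complexify P) = (MvPolynomial.eval ξ P : ℂ) := by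
  rw [complexify, MvPolynomial.eval_map]
  exact (MvPolynomial.eval₂_comp_left Complex.ofRealHom (RingHom.id ℝ) ξ P).symm

theorem complexify_isWeightedHomogeneous {σ M : Type*} [AddCommMonoid M] {wt : σ → M} {w : M}
    {P : MvPolynomial σ ℝ} (hP : P.IsWeightedHomogeneous wt w) :
    (complexify P).IsWeightedHomogeneous wt w := by
  intro s hs
  refine hP fun h => hs ?_
  rw [complexify, MvPolynomial.coeff_map, h, map_zero]

theorem symmetrization_eq (c : ℂ) (P : SymAlg n) :
    symmetrization n c P =
      symMap (fun p : PosRoot n => c • (vectorField p : Op n)) (complexify P) := by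
  conv_lhs => rw [P.as_sum]
  conv_rhs => rw [P.as_sum]
  rw [map_sum, map_sum, map_sum]
  refine Finset.sum_congr rfl fun s _ => ?_
  have h : MvPolynomial.monomial s (P.coeff s) =
      P.coeff s • MvPolynomial.basisMonomials (PosRoot n) ℝ s := by
    simp [MvPolynomial.smul_monomial]
  rw [complexify, MvPolynomial.map_monomial, symMap_monomial, h, map_smul, symmetrization,
    Module.Basis.constr_basis]
  rfl

theorem symmetrization_symbol (P : SymAlg n) :
    symmetrization n (-Complex.I) P = symMap symbolField (complexify P) :=
  symmetrization_eq _ P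

theorem orderAverage_smul {A : Type*} [Ring A] [Algebra ℂ A] {m : ℕ} (c : ℂ) (a : Fin m → A) :
    orderAverage (fun k => c • a k) = c ^ m • orderAverage a := by
  have h : ∀ π : Equiv.Perm (Fin m), (List.ofFn fun k => c • a (π k)).prod =
      c ^ m • (List.ofFn fun k => a (π k)).prod := fun π => by
    have := (MultilinearMap.mkPiAlgebraFin ℂ m A).map_smul_univ (fun _ => c) fun k => a (π k)
    simpa using this
  rw [orderAverage, orderAverage, Finset.sum_congr rfl fun π _ => h π, ← Finset.smul_sum,
    smul_comm]

theorem symMap_smul_of_isHomogeneous {ι A : Type*} [Ring A] [Algebra ℂ A] (V : ι → A) (c : ℂ)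
    {P : MvPolynomial ι ℂ} {d : ℕ} (hP : P.IsHomogeneous d) :
    symMap (fun p => c • V p) P = c ^ d • symMap V P := by
  rw [P.as_sum, map_sum, map_sum, Finset.smul_sum]
  refine Finset.sum_congr rfl fun s hs => ?_
  have hd : s.degree = d := by
    have := hP (MvPolynomial.mem_support_iff.1 hs)
    rwa [Finsupp.degree_eq_weight_one]
  rw [symMap_monomial, symMap_monomial, orderAverage_smul, smul_comm]
  exact congrArg (fun N => c ^ N • _) ((length_toList s).trans hd)

theorem isLeibniz_symbolField : IsLeibniz (symbolField (n := n)) :=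
  isLeibniz_vectorField.smul _

theorem commutatorsLinear_symbolField {M : Type*} [AddCommMonoid M] {wt : PosRoot n → M}
    (hwt : ∀ p q z : PosRoot n, p.1.2 = q.1.1 → z.1 = (p.1.1, q.1.2) → wt z = wt p + wt q) :
    CommutatorsLinear symbolField wt :=
  (commutatorsLinear_vectorField hwt).smul (neg_ne_zero.2 Complex.I_ne_zero)

theorem exists_symbolField_eq (ξ : PosRoot n → ℂ) :
    ∃ g : smoothFn n, evalAt 1 g = 0 ∧ ∀ p, evalAt 1 (symbolField p g) = ξ p := by
  refine ⟨linearFn fun p => Complex.I * ξ p, evalAt_one_linearFn _, fun p => ?_⟩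
  rw [symbolField, LinearMap.smul_apply, map_smul, evalAt_one_vectorField_linearFn, smul_eq_mul,
    ← mul_assoc, neg_mul, Complex.I_mul_I, neg_neg, one_mul]

theorem symMap_symbolField_injective : Function.Injective (symMap (symbolField (n := n))) :=
  symMap_injective isLeibniz_symbolField (evalAt 1) exists_symbolField_eq

theorem adjoin_symbolField :
    Algebra.adjoin ℂ (Set.range (symbolField (n := n))) = leftInvariantOps n := by
  refine le_antisymm (Algebra.adjoin_le ?_) (Algebra.adjoin_le ?_)
  · rintro _ ⟨p, rfl⟩
    exact Subalgebra.smul_mem _ (Algebra.subset_adjoin (Set.mem_range_self p)) _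
  · rintro _ ⟨p, rfl⟩
    have h : (vectorField p : Op n) = Complex.I • symbolField p := by
      rw [symbolField, smul_smul, mul_neg, Complex.I_mul_I, neg_neg, one_smul]
    rw [h]
    exact Subalgebra.smul_mem _ (Algebra.subset_adjoin (Set.mem_range_self p)) _

/-- The action of `Ad(c)` on the complexified symmetric algebra of `𝔫`. -/
def adAlg (c : borel n) : MvPolynomial (PosRoot n) ℂ →ₐ[ℂ] MvPolynomial (PosRoot n) ℂ :=
  MvPolynomial.aeval fun p => ∑ q, (adCoeff c p q : ℂ) • MvPolynomial.X q

theorem eval_adAlg (c : borel n) (ξ : PosRoot n → ℝ) (P : MvPolynomial (PosRoot n) ℂ) :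
    MvPolynomial.eval (fun p => (ξ p : ℂ)) (adAlg c P) =
      MvPolynomial.eval (fun p => (coAd c ξ p : ℂ)) P := by
  induction P using MvPolynomial.induction_on with
  | C a => simp [adAlg]
  | add p q hp hq => rw [map_add, map_add, map_add, hp, hq]
  | mul_X p i hp =>
    rw [map_mul, map_mul, map_mul, hp]
    simp only [adAlg, MvPolynomial.aeval_X, map_sum, MvPolynomial.smul_eval, MvPolynomial.eval_X,
      coAd, Complex.ofReal_sum, Complex.ofReal_mul]

theorem conj_symMap (c : borel n) (P : MvPolynomial (PosRoot n) ℂ) :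
    (rightTranslation c * symMap symbolField P * rightTranslation c⁻¹ : Op n) =
      symMap symbolField (adAlg c P) := by
  refine map_symMap (symbolField (n := n)) (conjTranslation c) (fun p q => (adCoeff c p q : ℂ)) (fun p => ?_) P
  rw [symbolField, map_smul]
  refine (congrArg _ (conj_vectorField c p)).trans ?_
  rw [Finset.smul_sum]
  exact Finset.sum_congr rfl fun q _ => smul_comm _ _ _

/-- Wolf's Dixmier–Pukanszky operator. -/
def wolfOperator (n : ℕ) : Op n := symMap symbolField (complexify (wolfSymbol n))

theorem funext_real {P Q : MvPolynomial (PosRoot n) ℂ}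
    (h : ∀ ξ : PosRoot n → ℝ, MvPolynomial.eval (fun p => (ξ p : ℂ)) P =
      MvPolynomial.eval (fun p => (ξ p : ℂ)) Q) : P = Q := by
  refine MvPolynomial.funext_set (fun _ => Set.range Complex.ofReal)
    (fun _ => Set.infinite_range_of_injective Complex.ofReal_injective) fun x hx => ?_
  choose y hy using fun p => hx p (Set.mem_univ p)
  rw [← funext hy]
  exact h y

theorem adAlg_wolfSymbol (c : borel n) :
    adAlg c (complexify (wolfSymbol n)) = (modularWeight c : ℂ) • complexify (wolfSymbol n) := by
  refine funext_real fun ξ => ?_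
  rw [eval_adAlg, eval_complexify, eval_wolfSymbol_coAd, MvPolynomial.smul_eval, eval_complexify,
    Complex.ofReal_mul]

theorem rootWeight_eq_add (p q z : PosRoot n) (h : p.1.2 = q.1.1) (hz : z.1 = (p.1.1, q.1.2)) :
    rootWeight z = rootWeight p + rootWeight q := by
  rw [rootWeight, rootWeight, rootWeight, hz, h]
  abel

theorem centerPoint_eq_zero {lam : Fin (n / 2) → ℝ} {p : PosRoot n} (hp : p.1.1.1 + p.1.2.1 + 1 ≠ n) :
    centerPoint lam p = 0 := by
  refine Finset.sum_eq_zero fun r _ => if_neg fun h => hp ?_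
  rw [h.1, h.2]
  simp only [cascadeCol, cascadeRow, Fin.val_rev]
  have := r.2
  omega

theorem list_sum_rootWeight (l : List (PosRoot n)) (h : Fin n → ℤ) :
    Fintype.linearCombination ℤ h (l.map rootWeight).sum =
      (l.map fun p => h p.1.1 - h p.1.2).sum := by
  rw [map_list_sum, List.map_map]
  congr 1
  refine List.map_congr_left fun p _ => ?_
  simp only [Function.comp_apply, rootWeight, map_sub, Fintype.linearCombination_apply_single,
    one_smul]

theorem linearCombination_symbolWeight (h : Fin n → ℤ) :
    Fintype.linearCombination ℤ h (symbolWeight n) =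
      ∑ r : Fin (n / 2), (stratumDim r + 1) • (h (cascadeRow r) - h (cascadeCol r)) := by
  simp only [symbolWeight, map_sum, map_nsmul, map_sub, Fintype.linearCombination_apply_single,
    one_smul]

/-- A word of the weight of the symbol either contains a letter of the polarization outside `𝔰`,
or is a product of `symbolDegree n` letters from `𝔰`. -/
theorem word_dichotomy (l : List (PosRoot n)) (hl : (l.map rootWeight).sum = symbolWeight n) :
    (∃ p ∈ l, p.1.1.1 + p.1.2.1 + 1 < n) ∨
      (l.length = symbolDegree n ∧ ∀ p ∈ l, p.1.1.1 + p.1.2.1 + 1 = n) := by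
  by_cases hex : ∃ p ∈ l, p.1.1.1 + p.1.2.1 + 1 < n
  · exact Or.inl hex
  push Not at hex
  refine Or.inr ?_
  have hrow : ∀ r : Fin (n / 2), (cascadeRow r).1 = r.1 := fun _ => rfl
  have hcol : ∀ r : Fin (n / 2), (cascadeCol r).1 = n - 1 - r.1 := fun r => by
    simp only [cascadeCol, cascadeRow, Fin.val_rev]; omega
  have hall : ∀ p ∈ l, p.1.1.1 + p.1.2.1 + 1 = n := by
    let h : Fin n → ℤ := fun i => -|2 * (i.1 : ℤ) + 1 - n|
    have h0 : (l.map fun p => h p.1.1 - h p.1.2).sum = 0 := by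
      rw [← list_sum_rootWeight, hl, linearCombination_symbolWeight]
      refine Finset.sum_eq_zero fun r _ => ?_
      have : h (cascadeRow r) = h (cascadeCol r) := by
        simp only [h, hrow, hcol]
        have := r.2
        rw [neg_inj, ← abs_neg]
        congr 1
        omega
      rw [this, sub_self, smul_zero]
    have hpos : ∀ p ∈ l, 0 ≤ h p.1.1 - h p.1.2 ∧
        (h p.1.1 - h p.1.2 ≤ 0 → p.1.1.1 + p.1.2.1 + 1 = n) := by
      intro p hp
      have h1 := hex p hp
      have h2 := Fin.lt_def.1 p.2
      simp only [h]
      rcases abs_cases (2 * (p.1.1.1 : ℤ) + 1 - n) with ⟨e1, _⟩ | ⟨e1, _⟩ <;>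
      rcases abs_cases (2 * (p.1.2.1 : ℤ) + 1 - n) with ⟨e2, _⟩ | ⟨e2, _⟩ <;>
      rw [e1, e2] <;> constructor <;> omega
    intro p hp
    refine (hpos p hp).2 ?_
    rw [← h0]
    refine List.single_le_sum (fun x hx => ?_) _ (List.mem_map_of_mem hp)
    obtain ⟨q, hq, rfl⟩ := List.mem_map.1 hx
    exact (hpos q hq).1
  refine ⟨?_, hall⟩
  let h : Fin n → ℤ := fun i => if i.1 < n / 2 then 1 else 0
  have h1 := list_sum_rootWeight l h
  have h2 : (l.map fun p => h p.1.1 - h p.1.2) = l.map fun _ => (1 : ℤ) := by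
    refine List.map_congr_left fun p hp => ?_
    have h3 := hall p hp
    have h4 := Fin.lt_def.1 p.2
    simp only [h]
    rw [if_pos (by omega), if_neg (by omega)]
    rfl
  rw [h2, hl, linearCombination_symbolWeight, List.map_const', List.sum_replicate] at h1
  have h3 : ∀ r : Fin (n / 2), h (cascadeRow r) - h (cascadeCol r) = 1 := fun r => by
    simp only [h, hrow, hcol]
    have := r.2
    rw [if_pos (by omega), if_neg (by omega)]
    rfl
  simp only [h3, nsmul_eq_mul, mul_one] at h1
  rw [symbolDegree]
  exact_mod_cast h1.symm

theorem wolfOperator_apply {lam : Fin (n / 2) → ℝ} {f : smoothFn n} (hf : HasFrequency lam f) :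
    wolfOperator n f = ((pfaffian lam * detCenters lam : ℝ) : ℂ) • f := by
  have hV : ∀ p : PosRoot n, p.1.1.1 + p.1.2.1 < n →
      symbolField p f = (centerPoint lam p : ℂ) • f := fun p hp => by
    rw [symbolField, LinearMap.smul_apply, vectorField_apply_of_hasFrequency hf hp, smul_smul,
      ← mul_assoc, neg_mul, Complex.I_mul_I, neg_neg, one_mul]
  rw [wolfOperator, symMap_apply_eq (commutatorsLinear_symbolField rootWeight_eq_add)
    (χ := fun p => (centerPoint lam p : ℂ)) (d := symbolDegree n) (fun l hl => ?_)
    (complexify_isWeightedHomogeneous wolfSymbol_isWeightedHomogeneous)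
    (MvPolynomial.IsHomogeneous.totalDegree_le
      (complexify_isWeightedHomogeneous wolfSymbol_isHomogeneous)),
    eval_complexify, eval_wolfSymbol_centerPoint]
  rcases word_dichotomy l hl with ⟨p, hp, hlt⟩ | ⟨hd, hall⟩
  · have h0 : (centerPoint lam p : ℂ) = 0 := by
      rw [centerPoint_eq_zero hlt.ne, Complex.ofReal_zero]
    refine Or.inl ⟨p, hp, ?_, h0⟩
    rw [hV p (by omega), h0, zero_smul]
  · exact Or.inr ⟨hd, fun p hp => hV p (by have := hall p hp; omega)⟩

theorem isWolfOperator_wolfOperator : IsWolfOperator (wolfOperator n) where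
  leftInvariant := by
    rw [← adjoin_symbolField]
    exact symMap_mem_adjoin symbolField (complexify (wolfSymbol n))
  semiInvariant c := by
    rw [wolfOperator, conj_symMap, adAlg_wolfSymbol, map_smul]
  fourier _ _ _ hf := wolfOperator_apply hf

theorem eval_wolfSymbol_basePoint : MvPolynomial.eval (basePoint n) (wolfSymbol n) = 1 := by
  rw [basePoint, eval_wolfSymbol_centerPoint]
  simp [pfaffian, detCenters]

theorem IsWolfOperator.eq_wolfOperator {D : Op n} (hD : IsWolfOperator D) :
    D = wolfOperator n := by
  have hmem := hD.leftInvariant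
  rw [← adjoin_symbolField] at hmem
  obtain ⟨P, rfl⟩ := adjoin_le_range_symMap (V := symbolField (n := n))
    (commutatorsLinear_symbolField fun _ _ _ _ _ => rfl) hmem
  have hP : ∀ c : borel n, adAlg c P = (modularWeight c : ℂ) • P := fun c => by
    refine symMap_symbolField_injective ?_
    rw [← conj_symMap, hD.semiInvariant, map_smul]
  set a := MvPolynomial.eval (fun p => (basePoint n p : ℂ)) P with ha
  have h0 : P - a • complexify (wolfSymbol n) = 0 := by
    refine eq_zero_of_forall_eval_coAd_basePoint fun c => ?_
    rw [← eval_adAlg, map_sub, map_smul, hP, adAlg_wolfSymbol, map_sub, MvPolynomial.smul_eval,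
      MvPolynomial.smul_eval, MvPolynomial.smul_eval, eval_complexify, eval_wolfSymbol_basePoint,
      ← ha]
    push_cast
    ring
  rw [sub_eq_zero] at h0
  have h1 : symMap symbolField P = a • wolfOperator n := by
    rw [h0, map_smul, wolfOperator]
  have hf := hasFrequency_frequencyFn (n := n) fun _ => 1
  have h2 := hD.fourier (fun _ => 1) (fun _ => one_ne_zero) _ hf
  have hone : pfaffian (n := n) (fun _ => 1) * detCenters (n := n) (fun _ => 1) = 1 := by
    simp [pfaffian, detCenters]
  rw [h1, LinearMap.smul_apply, wolfOperator_apply hf, hone, Complex.ofReal_one, one_smul] at h2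
  have h3 : a * (frequencyFn (n := n) fun _ => 1).1 1 = (frequencyFn (n := n) fun _ => 1).1 1 :=
    congrArg (evalAt 1) h2
  have ha1 : a = 1 := (mul_eq_right₀ (frequencyFn_apply_ne_zero _ _)).1 h3
  rw [h1, ha1, one_smul]

theorem wolfSymbol_ne_zero : wolfSymbol n ≠ 0 := fun h => by
  have := eval_wolfSymbol_basePoint (n := n)
  rw [h, map_zero] at this
  exact zero_ne_one this

theorem totalDegree_wolfSymbol : (wolfSymbol n).totalDegree = symbolDegree n :=
  wolfSymbol_isHomogeneous.totalDegree wolfSymbol_ne_zero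

theorem hasOrder_wolfOperator : HasOrder (wolfOperator n) (symbolDegree n) := by
  have hdeg : (complexify (wolfSymbol n)).IsHomogeneous (symbolDegree n) :=
    complexify_isWeightedHomogeneous wolfSymbol_isHomogeneous
  refine ⟨fun b f hf => ?_, fun j hj hle => ?_⟩
  · have hx : ∏ i, f i ∈ RingHom.ker (evalAt b) ^ (symbolDegree n + 1) := by
      have := Ideal.prod_mem_prod (s := Finset.univ) (I := fun _ => RingHom.ker (evalAt b))
        (x := f) fun i _ => hf i
      simpa using this
    exact isLeibniz_symbolField.symMap_prod_mem _ hdeg.totalDegree_le hx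
  · obtain ⟨g, hg0, hg⟩ := exists_symbolField_eq fun p => (basePoint n p : ℂ)
    have h := eval_symMap_pow isLeibniz_symbolField (evalAt 1) hg0 hdeg.totalDegree_le
    rw [MvPolynomial.homogeneousComponent_of_mem hdeg, if_pos rfl, funext hg, eval_complexify,
      eval_wolfSymbol_basePoint, Complex.ofReal_one, mul_one] at h
    have h1 := hle 1 (fun i => if i = Fin.last j then g ^ (symbolDegree n - j) else g) fun i => by
      split_ifs
      · change evalAt 1 (g ^ _) = 0
        rw [map_pow, hg0, zero_pow (by omega)]
      · exact hg0
    rw [Fin.prod_univ_castSucc, if_pos rfl] at h1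
    simp only [(Fin.castSucc_lt_last _).ne, if_false, Finset.prod_const, Finset.card_univ,
      Fintype.card_fin] at h1
    rw [← pow_add, Nat.add_sub_cancel' hj.le] at h1
    have h2 : ((symbolDegree n).factorial : ℂ) = 0 := h.symm.trans h1
    exact (symbolDegree n).factorial_ne_zero (by exact_mod_cast h2)

theorem wolfOperator_eq_smul :
    wolfOperator n = (-Complex.I) ^ symbolDegree n • symmetrization n 1 (wolfSymbol n) := by
  rw [symmetrization_eq]
  simp only [one_smul]
  exact symMap_smul_of_isHomogeneous vectorField (-Complex.I)
    (complexify_isWeightedHomogeneous wolfSymbol_isHomogeneous)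

end DixmierPukanszky

end

open DixmierPukanszky in
theorem corollary3p4 (n : ℕ) :
    ∃ D : Op n,
      (IsWolfOperator D ∧ ∀ D', IsWolfOperator D' → D' = D) ∧
      ∃ P : SymAlg n,
        (IsSymbol P D ∧ ∀ P', IsSymbol P' D → P' = P) ∧
        IsCoadjointInvariant P ∧
        (∃! Q : MvPolynomial (Fin (n / 2)) ℝ,
          MvPolynomial.aeval (fun r : Fin (n / 2) => chopInvariant n (r.1 + 1)) Q = P) ∧
        (Odd n →
          P = ∏ r ∈ Finset.Icc 1 (n / 2), chopInvariant n r ^ 2 ∧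
          P.IsHomogeneous (n / 2 * (n / 2 + 1)) ∧
          D = (-Complex.I) ^ (n / 2 * (n / 2 + 1)) • symmetrization n 1 P) ∧
        (Even n →
          P = (-1) ^ (n / 2 * (n / 2 - 1) / 2) *
            (chopInvariant n (n / 2) *
              ∏ r ∈ Finset.Icc 1 (n / 2 - 1), chopInvariant n r ^ 2) ∧
          P.IsHomogeneous ((n / 2) ^ 2) ∧
          D = (-Complex.I) ^ ((n / 2) ^ 2) • symmetrization n 1 P) ∧
        2 * P.totalDegree =
          Module.finrank ℝ (nilradical n) + Module.finrank ℝ (centers n) ∧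
        HasOrder D P.totalDegree := by
  refine ⟨wolfOperator n, ⟨isWolfOperator_wolfOperator, fun _ h => h.eq_wolfOperator⟩,
    wolfSymbol n, ⟨symmetrization_symbol _, fun P' h => ?_⟩, isCoadjointInvariant_wolfSymbol,
    ⟨symbolInMinors n, aeval_symbolInMinors, fun Q hQ => ?_⟩, fun hn => ?_, fun hn => ?_, ?_, ?_⟩
  · refine complexify_injective (symMap_symbolField_injective ?_)
    rw [← symmetrization_symbol]
    exact h
  · exact aeval_chopInvariant_injective (hQ.trans aeval_symbolInMinors.symm)
  · rw [← symbolDegree_of_odd hn]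
    exact ⟨wolfSymbol_of_odd hn, wolfSymbol_isHomogeneous, wolfOperator_eq_smul⟩
  · rw [← symbolDegree_of_even hn]
    exact ⟨wolfSymbol_of_even hn, wolfSymbol_isHomogeneous, wolfOperator_eq_smul⟩
  · rw [totalDegree_wolfSymbol, two_mul_symbolDegree, finrank_nilradical, finrank_centers]
  · rw [totalDegree_wolfSymbol]
    exact hasOrder_wolfOperator
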